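/- Let $\alpha\in(0,1)$, let $(N'(t))_{t\ge0}$ be a standard Poisson process on a probability space $(\Omega',\mathbb P')$ with expectation $\mathbb E'$, and let $\mathcal M_\alpha$ be a centered Gaussian random measure, defined on a probability space $(\Omega,\mathbb P)$, on $\mathbb R_+\times\Omega'$ with control measure $\alpha r^{-\alpha-1}\,\mathrm dr\,\mathrm d\mathbb P'$. (That is, with $\mu$ the control measure, $(\mathcal M_\alpha(A))_{\mu(A)<\infty}$ is a centered Gaussian process with $\mathrm{Cov}(\mathcal M_\alpha(A),\mathcal M_\alpha(B))=\mu(A\cap B)$; for $f\in L^2(\mu)$, $\int f\,\mathrm d\mathcal M_\alpha$ is the limit in $L^2(\mathbb P)$ of the integrals of simple functions converging to $f$ in $L^2(\mu)$.) Let $(a_j)_{j\ge0}$ be real numbers with $a_0=0$ and put $$\mathcal Z_\alpha(t):=\int_{\mathbb R_+\times\Omega'}\bigl(a_{N'(rt)}-\mathbb E' a_{N'(rt)}\bigr)\,\mathcal M_\alpha(\mathrm dr,\mathrm d\omega'),\qquad t\ge0.$$ **(i)** Assume that $|a_j|\le Cj^\beta$ for all $j\ge1$, for some constants $C\in\mathbb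 R$ and $\beta\in[0,\alpha/2)$. Then, for every $t\ge 0$, $\mathbb E'|a_{N'(t)}|<\infty$, the integrand defining $\mathcal Z_\alpha(t)$ is square-integrable for the control measure, and the stochastic integral exists and is unique up to almost sure equality. The family $(\mathcal Z_\alpha(t))_{t\ge0}$ is a centered (jointly) Gaussian family, and for $0<s<t$, $$\mathrm{Cov}(\mathcal Z_\alpha(s),\mathcal Z_\alpha(t))=\alpha t^\alpha\sum_{k=1}^\infty\frac{F^{(1)}_{s,t}(k)\,\Gamma(k-\alpha)}{k!}-\alpha(s+t)^\alpha\sum_{k=2}^\infty\frac{F^{(2)}_{s,t}(k)\,\Gamma(k-\alpha)}{k!},$$ where both series converge absolutely and $$F^{(1)}_{s,t}(k)=\sum_{j=1}^k\binom kj\Bigl(\frac st\Bigr)^j\Bigl(1-\frac st\Bigr)^{k-j}a_ja_k,\qquad F^{(2)}_{s,t}(k)=\sum_{j=1}^{k-1}\binom kj\Bigl(\frac s{s+t}\Bigr)^j\Bigl(\frac t{s+t}\Bigr)^{k-j}a_ja_{k-j}.$$ **(ii)** If moreover $|a_{i+j}-a_i|\le C'j^{\beta'}$ for all $i,j\ge1$,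 for some constants $C'\in\mathbb R$ and $\beta'\in[0,\alpha/2)$, then $(\mathcal Z_\alpha(t))_{t\ge0}$ has a version $(Y(t))_{t\ge0}$ (each $Y(t)$ is a random variable with $Y(t)=\mathcal Z_\alpha(t)$ almost surely) all of whose paths are, for every $\gamma\in(0,\alpha/2)$, $\gamma$-Hölder continuous on every compact interval $[0,T]$. -/

import Mathlib

open MeasureTheory ProbabilityTheory Set Filter Topology
open scoped NNReal ENNReal Nat

/-- `N` is a standard (rate one) Poisson process under `P'`: it starts at `0` almost surely, has
independent increments, the increment over `[s, t]` has the Poisson law of parameter `t - s`, and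
almost every path is nondecreasing and right-continuous. (Subtraction is that of `ℕ`; as almost
every path is nondecreasing, it never truncates outside a null set.) -/
structure IsStandardPoissonProcess {Ω' : Type*} [MeasurableSpace Ω'] (N : ℝ≥0 → Ω' → ℕ)
    (P' : Measure Ω') : Prop where
  measurable : ∀ t, Measurable (N t)
  zero_ae : ∀ᵐ ω' ∂P', N 0 ω' = 0
  indep : HasIndepIncrements N P'
  law : ∀ s t, s ≤ t → HasLaw (fun ω' => N t ω' - N s ω') (poissonMeasure (t - s)) P'
  paths : ∀ᵐ ω' ∂P', Monotone (fun t => N t ω') ∧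
    ∀ t, ContinuousWithinAt (fun u => N u ω') (Ici t) t

/-- `M` is a (centered) Gaussian random measure with control measure `μ`: the family `M A`, over
the measurable sets `A` of finite `μ`-measure, is a centered Gaussian process with
`Cov (M A, M B) = μ (A ∩ B)`. The value of `M` at other sets is irrelevant. -/
structure IsGaussianRandomMeasure {E Ω : Type*} [MeasurableSpace E] [MeasurableSpace Ω]
    (M : Set E → Ω → ℝ) (μ : Measure E) (P : Measure Ω) : Prop where
  gaussian : IsGaussianProcess (fun A : {A : Set E // MeasurableSet A ∧ μ A < ∞} => M A.1) P
  centered : ∀ A, MeasurableSet A → μ A < ∞ → ∫ ω, M A ω ∂P = 0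
  covariance_eq : ∀ A B, MeasurableSet A → μ A < ∞ → MeasurableSet B → μ B < ∞ →
    cov[M A, M B; P] = μ.real (A ∩ B)

/-- The stochastic integral of a simple function `g`, namely `∑ y, y * M {g = y}`. -/
noncomputable def simpleStochInt {E Ω : Type*} [MeasurableSpace E] (M : Set E → Ω → ℝ)
    (g : SimpleFunc E ℝ) (ω : Ω) : ℝ :=
  ∑ y ∈ g.range, y * M (g ⁻¹' {y}) ω

/-- `X` is (a representative of) the stochastic integral `∫ f dM` of `f ∈ L²(μ)`: it is the limit in
`L²(P)` of the integrals of simple functions that converge to `f` in `L²(μ)`. -/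
def IsStochInt {E Ω : Type*} [MeasurableSpace E] [MeasurableSpace Ω]
    (M : Set E → Ω → ℝ) (μ : Measure E) (P : Measure Ω) (f : E → ℝ) (X : Ω → ℝ) : Prop :=
  MemLp f 2 μ ∧ MemLp X 2 P ∧
    ∃ g : ℕ → SimpleFunc E ℝ, (∀ n, MemLp (g n) 2 μ) ∧
      Tendsto (fun n => eLpNorm (fun x => f x - g n x) 2 μ) atTop (𝓝 0) ∧
      Tendsto (fun n => eLpNorm (fun ω => X ω - simpleStochInt M (g n) ω) 2 P) atTop (𝓝 0)

open Classical in
/-- The stochastic integral `∫ f dM` (some representative of it; `0` if there is none). -/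
noncomputable def stochInt {E Ω : Type*} [MeasurableSpace E] [MeasurableSpace Ω]
    (M : Set E → Ω → ℝ) (μ : Measure E) (P : Measure Ω) (f : E → ℝ) : Ω → ℝ :=
  if h : ∃ X, IsStochInt M μ P f X then h.choose else 0

/-- The measure `α r^(-α-1) dr` on `ℝ₊`. -/
noncomputable def radialMeasure (α : ℝ) : Measure ℝ≥0 :=
  ((volume.restrict (Ioi (0 : ℝ))).withDensity
    (fun r => ENNReal.ofReal (α * r ^ (-α - 1)))).map Real.toNNReal

/-- The intensity measure `α r^(-α-1) dr dP'` on `ℝ₊ × Ω'`. -/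
noncomputable def intensity {Ω' : Type*} [MeasurableSpace Ω'] (α : ℝ) (P' : Measure Ω') :
    Measure (ℝ≥0 × Ω') :=
  (radialMeasure α).prod P'

/-- The integrand `(r, ω') ↦ a_{N(rt)}(ω') - E' a_{N(rt)}`. -/
noncomputable def zKernel {Ω' : Type*} [MeasurableSpace Ω'] (a : ℕ → ℝ) (N : ℝ≥0 → Ω' → ℕ)
    (P' : Measure Ω') (t : ℝ≥0) (x : ℝ≥0 × Ω') : ℝ :=
  a (N (x.1 * t) x.2) - ∫ ω', a (N (x.1 * t) ω') ∂P'

/-- The process `Z_α(t) = ∫ (a_{N(rt)} - E' a_{N(rt)}) M(dr, dω')`, `t ≥ 0`. -/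
noncomputable def karlinZ {Ω Ω' : Type*} [MeasurableSpace Ω] [MeasurableSpace Ω']
    (α : ℝ) (a : ℕ → ℝ) (N : ℝ≥0 → Ω' → ℕ) (P' : Measure Ω')
    (M : Set (ℝ≥0 × Ω') → Ω → ℝ) (P : Measure Ω) (t : ℝ≥0) : Ω → ℝ :=
  stochInt M (intensity α P') P (zKernel a N P' t)

/-- `F⁽¹⁾(k) = ∑_{j=1}^k C(k,j) (s/t)^j (1-s/t)^(k-j) a_j a_k`. -/
noncomputable def weightF1 (a : ℕ → ℝ) (s t : ℝ) (k : ℕ) : ℝ :=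
  ∑ j ∈ Finset.Icc 1 k, (k.choose j : ℝ) * (s / t) ^ j * (1 - s / t) ^ (k - j) * a j * a k

/-- `F⁽²⁾(k) = ∑_{j=1}^{k-1} C(k,j) (s/(s+t))^j (t/(s+t))^(k-j) a_j a_{k-j}`. -/
noncomputable def weightF2 (a : ℕ → ℝ) (s t : ℝ) (k : ℕ) : ℝ :=
  ∑ j ∈ Finset.Icc 1 (k - 1),
    (k.choose j : ℝ) * (s / (s + t)) ^ j * (t / (s + t)) ^ (k - j) * a j * a (k - j)

/-- The terms `F⁽¹⁾(k) Γ(k-α) / k!` of the first covariance series. -/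
noncomputable def covTerm1 (α : ℝ) (a : ℕ → ℝ) (s t : ℝ) (k : ℕ) : ℝ :=
  weightF1 a s t k * Real.Gamma (k - α) / (k ! : ℝ)

/-- The terms `F⁽²⁾(k) Γ(k-α) / k!` of the second covariance series. -/
noncomputable def covTerm2 (α : ℝ) (a : ℕ → ℝ) (s t : ℝ) (k : ℕ) : ℝ :=
  weightF2 a s t k * Real.Gamma (k - α) / (k ! : ℝ)

/-! Everything rests on the isometry `E[∫ f dM · ∫ h dM] = ∫ f h dμ`. For simple functions it is
bilinearity combined with `Cov(M A, M B) = μ(A ∩ B)`, and it passes to L² limits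
(`integral_mul_of_isStochInt`). It gives existence and uniqueness of the integral. Since L² limits
of Gaussian variables are Gaussian, the integrals are jointly Gaussian
(`isGaussianProcess_of_isStochInt`).

Square-integrability: off `{N(rt) = 0}` the square of `a_{N(rt)}` is at most a constant times `N(rt)
^ p`, with `p = 2β < α`. The mean of that power is at most `rt` and at most `2 (rt) ^ p`. Against `r
^ (-α - 1) dr` the first bound is integrable at `0` because `α < 1`, the second at infinity because
`p < α`, and scaling produces `t ^ α`. Increments `N(rt) - N(rs)` are treated alike and produce `(t
- s) ^ α` (`lintegral_radialMeasure_le`).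

Covariance: by the isometry and Fubini it is the radial integral of `E'[a_{N(rs)} a_{N(rt)}] - E'
a_{N(rs)} · E' a_{N(rt)}`. Each term is the mean of a function of two independent Poisson variables,
with total parameter `rt`, respectively `r(s + t)`. Given their sum `k`, the first is binomial with
a success probability free of `r`. Hence only the Poisson weight of `k` is integrated in `r`, which
is a Gamma integral (`integral_radialMeasure_poissonMeasure_prod`).

Paths: the isometry gives `E|Z(t) - Z(s)|² ≤ c |t - s| ^ α`. By Gaussianity the moment of order `2p`
is then at most a constant times `|t - s| ^ (pα)` for every `p`, and Kolmogorov–Chentsov yields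
every Hölder exponent below `α / 2` (`exists_modification_holder`). -/

/-! ### Limits in L² -/

section LpLimits

variable {Ω E : Type*} [MeasurableSpace Ω] [MeasurableSpace E] {P : Measure Ω} {μ : Measure E}

/-- Convergence in `L²` of two sequences gives convergence of the integrals of the products. -/
lemma tendsto_integral_mul_of_tendsto_eLpNorm {X Y : Ω → ℝ} {Xn Yn : ℕ → Ω → ℝ}
    (hX : MemLp X 2 P) (hY : MemLp Y 2 P) (hXn : ∀ n, MemLp (Xn n) 2 P)
    (hYn : ∀ n, MemLp (Yn n) 2 P)
    (h1 : Tendsto (fun n => eLpNorm (X - Xn n) 2 P) atTop (𝓝 0))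
    (h2 : Tendsto (fun n => eLpNorm (Y - Yn n) 2 P) atTop (𝓝 0)) :
    Tendsto (fun n => ∫ ω, Xn n ω * Yn n ω ∂P) atTop (𝓝 (∫ ω, X ω * Y ω ∂P)) := by
  simp_rw [eLpNorm_sub_comm X] at h1
  simp_rw [eLpNorm_sub_comm Y] at h2
  rw [← Lp.tendsto_Lp_iff_tendsto_eLpNorm'' Xn hXn X hX] at h1
  rw [← Lp.tendsto_Lp_iff_tendsto_eLpNorm'' Yn hYn Y hY] at h2
  have h := h1.inner (𝕜 := ℝ) h2
  have key : ∀ {U V : Ω → ℝ} (hU : MemLp U 2 P) (hV : MemLp V 2 P),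
      inner ℝ (hU.toLp U) (hV.toLp V) = ∫ ω, U ω * V ω ∂P := by
    intro U V hU hV
    rw [L2.inner_def]
    apply integral_congr_ae
    filter_upwards [hU.coeFn_toLp, hV.coeFn_toLp] with ω h1 h2
    simp [h1, h2, mul_comm]
  simpa only [key] using h

lemma tendsto_integral_of_tendsto_eLpNorm_two [IsProbabilityMeasure P] {X : Ω → ℝ}
    {Xn : ℕ → Ω → ℝ} (hX : MemLp X 2 P) (hXn : ∀ n, MemLp (Xn n) 2 P)
    (h1 : Tendsto (fun n => eLpNorm (X - Xn n) 2 P) atTop (𝓝 0)) :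
    Tendsto (fun n => ∫ ω, Xn n ω ∂P) atTop (𝓝 (∫ ω, X ω ∂P)) := by
  have h := tendsto_integral_mul_of_tendsto_eLpNorm (Y := fun _ => 1) (Yn := fun _ _ => 1)
    hX (memLp_const 1) hXn (fun _ => memLp_const 1) h1 (by simp)
  simpa using h

lemma integral_sub_sq_eq {X Y : Ω → ℝ} (hX : MemLp X 2 P) (hY : MemLp Y 2 P) :
    ∫ ω, (X ω - Y ω) ^ 2 ∂P
      = ∫ ω, X ω * X ω ∂P - 2 * ∫ ω, X ω * Y ω ∂P + ∫ ω, Y ω * Y ω ∂P := by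
  have h1 := hX.integrable_mul hX
  have h2 := hX.integrable_mul hY
  have h3 := hY.integrable_mul hY
  simp only [Pi.mul_def] at h1 h2 h3
  rw [← integral_const_mul, ← integral_sub h1 (h2.const_mul 2), ← integral_add _ h3]
  · exact integral_congr_ae (ae_of_all _ fun ω => by ring)
  · exact h1.sub (h2.const_mul 2)

/-- Two pairs of square-integrable functions with the same Gram matrix are equally distant. -/
lemma eLpNorm_sub_eq_of_integral_mul_eq {X Y : Ω → ℝ} {f h : E → ℝ} (hX : MemLp X 2 P)
    (hY : MemLp Y 2 P) (hf : MemLp f 2 μ) (hh : MemLp h 2 μ)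
    (h1 : ∫ ω, X ω * X ω ∂P = ∫ x, f x * f x ∂μ) (h2 : ∫ ω, X ω * Y ω ∂P = ∫ x, f x * h x ∂μ)
    (h3 : ∫ ω, Y ω * Y ω ∂P = ∫ x, h x * h x ∂μ) :
    eLpNorm (X - Y) 2 P = eLpNorm (f - h) 2 μ := by
  rw [(hX.sub hY).eLpNorm_eq_integral_rpow_norm (by norm_num) (by norm_num),
    (hf.sub hh).eLpNorm_eq_integral_rpow_norm (by norm_num) (by norm_num)]
  congr 2
  simp only [Pi.sub_apply, ENNReal.toReal_ofNat, Real.rpow_two, Real.norm_eq_abs, sq_abs]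
  rw [integral_sub_sq_eq hX hY, integral_sub_sq_eq hf hh, h1, h2, h3]

/-- A limit in `L²` of Gaussian random variables is Gaussian. -/
lemma HasGaussianLaw.of_tendsto_eLpNorm [IsProbabilityMeasure P] {X : Ω → ℝ}
    {Xn : ℕ → Ω → ℝ} (hX : MemLp X 2 P) (hXn : ∀ n, HasGaussianLaw (Xn n) P)
    (h1 : Tendsto (fun n => eLpNorm (X - Xn n) 2 P) atTop (𝓝 0)) :
    HasGaussianLaw X P := by
  have hXn2 : ∀ n, MemLp (Xn n) 2 P := fun n => (hXn n).memLp_two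
  -- L² convergence carries means and variances to the limit and implies convergence in
  -- distribution. The Gaussian characteristic functions therefore converge to the one of the limit
  -- law, which may be degenerate.
  have hmean := tendsto_integral_of_tendsto_eLpNorm_two hX hXn2 h1
  have hsq := tendsto_integral_mul_of_tendsto_eLpNorm hX hX hXn2 hXn2 h1 h1
  have hvar : Tendsto (fun n => Var[Xn n; P]) atTop (𝓝 Var[X; P]) := by
    simp_rw [variance_eq_sub hX, variance_eq_sub (hXn2 _), pow_two]
    exact hsq.sub (hmean.mul hmean)
  have hmeas : TendstoInMeasure P Xn atTop X := by
    refine tendstoInMeasure_of_tendsto_eLpNorm (p := 2) (by norm_num)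
      (fun n => (hXn2 n).aestronglyMeasurable) hX.aestronglyMeasurable ?_
    simpa only [eLpNorm_sub_comm X] using h1
  have hdist := hmeas.tendstoInDistribution (fun n => (hXn2 n).aestronglyMeasurable.aemeasurable)
  have hchar := (ProbabilityMeasure.tendsto_iff_tendsto_charFun).1 hdist.tendsto
  have hlaw : ∀ n, P.map (Xn n) = gaussianReal (∫ ω, Xn n ω ∂P) Var[Xn n; P].toNNReal := by
    intro n
    have hm := (hXn2 n).aestronglyMeasurable.aemeasurable
    rw [(hXn n).isGaussian_map.eq_gaussianReal, integral_map hm (by fun_prop),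
      variance_map (by fun_prop) hm]
    simp
  refine ⟨?_⟩
  have : P.map X = gaussianReal (∫ ω, X ω ∂P) Var[X; P].toNNReal := by
    have := Measure.isProbabilityMeasure_map (μ := P) hX.aestronglyMeasurable.aemeasurable
    refine Measure.ext_of_charFun (funext fun t => ?_)
    refine tendsto_nhds_unique (hchar t) ?_
    simp only [ProbabilityMeasure.coe_mk, hlaw, charFun_gaussianReal]
    refine (Complex.continuous_exp.tendsto _).comp ?_
    refine Tendsto.sub ?_ ?_
    · exact (tendsto_const_nhds.mul ((Complex.continuous_ofReal.tendsto _).comp hmean)).mul_const _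
    · refine Tendsto.div_const (Tendsto.mul_const _ ?_) _
      simp only [Real.coe_toNNReal _ (variance_nonneg _ _)]
      exact (Complex.continuous_ofReal.tendsto _).comp hvar
  rw [this]
  infer_instance

end LpLimits

/-! ### Gaussian stochastic integrals -/

section StochInt

variable {Ω E : Type*} [MeasurableSpace Ω] [MeasurableSpace E] {P : Measure Ω} {μ : Measure E}
  {M : Set E → Ω → ℝ}

/-- The fiber over `0` may have infinite measure, and there `M` is unconstrained. Its coefficient
vanishes, which explains the recurring case split on `y = 0`. -/
lemma measure_fiber_lt_top {g : SimpleFunc E ℝ} (hg : MemLp g 2 μ) {y : ℝ} (hy : y ≠ 0) :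
    μ (g ⁻¹' {y}) < ∞ :=
  SimpleFunc.measure_preimage_lt_top_of_memLp (by norm_num) (by norm_num) g hg y hy

namespace IsGaussianRandomMeasure

variable (hM : IsGaussianRandomMeasure M μ P)

include hM

lemma memLp_two {A : Set E} (hA : MeasurableSet A) (hA' : μ A < ∞) : MemLp (M A) 2 P :=
  (hM.gaussian.hasGaussianLaw_eval ⟨A, hA, hA'⟩).memLp_two

lemma integral_mul [IsProbabilityMeasure P] {A B : Set E} (hA : MeasurableSet A) (hA' : μ A < ∞)
    (hB : MeasurableSet B) (hB' : μ B < ∞) : ∫ ω, M A ω * M B ω ∂P = μ.real (A ∩ B) := by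
  rw [← hM.covariance_eq A B hA hA' hB hB',
    covariance_eq_sub (hM.memLp_two hA hA') (hM.memLp_two hB hB'), hM.centered A hA hA']
  simp

lemma memLp_mul_fiber {g : SimpleFunc E ℝ} (hg : MemLp g 2 μ) (y : ℝ) :
    MemLp (fun ω => y * M (g ⁻¹' {y}) ω) 2 P := by
  by_cases hy : y = 0
  · simp [hy]
  · exact (hM.memLp_two (g.measurableSet_fiber y) (measure_fiber_lt_top hg hy)).const_mul y

lemma memLp_simpleStochInt {g : SimpleFunc E ℝ} (hg : MemLp g 2 μ) :
    MemLp (simpleStochInt M g) 2 P :=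
  memLp_finsetSum _ fun y _ => hM.memLp_mul_fiber hg y

lemma integral_simpleStochInt [IsProbabilityMeasure P] {g : SimpleFunc E ℝ} (hg : MemLp g 2 μ) :
    ∫ ω, simpleStochInt M g ω ∂P = 0 := by
  unfold simpleStochInt
  rw [integral_finsetSum _ fun y _ => (hM.memLp_mul_fiber hg y).integrable (by norm_num)]
  refine Finset.sum_eq_zero fun y _ => ?_
  rw [integral_const_mul]
  by_cases hy : y = 0
  · simp [hy]
  · rw [hM.centered _ (g.measurableSet_fiber y) (measure_fiber_lt_top hg hy), mul_zero]

/-- The isometry for simple functions: both sides expand over pairs of fibers, and the terms agree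
by the covariance of `M`. -/
lemma integral_simpleStochInt_mul [IsProbabilityMeasure P] {g h : SimpleFunc E ℝ}
    (hg : MemLp g 2 μ) (hh : MemLp h 2 μ) :
    ∫ ω, simpleStochInt M g ω * simpleStochInt M h ω ∂P = ∫ x, g x * h x ∂μ := by
  have hl : ∀ ω, simpleStochInt M g ω * simpleStochInt M h ω
      = ∑ y ∈ g.range, ∑ z ∈ h.range, (y * M (g ⁻¹' {y}) ω) * (z * M (h ⁻¹' {z}) ω) := by
    intro ω
    rw [simpleStochInt, simpleStochInt, Finset.sum_mul_sum]
  have hr : ∀ x, g x * h x = ∑ y ∈ g.range, ∑ z ∈ h.range,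
      (g ⁻¹' {y} ∩ h ⁻¹' {z}).indicator (fun _ => y * z) x := by
    intro x
    rw [Finset.sum_eq_single (g x), Finset.sum_eq_single (h x)]
    · simp
    · intro z _ hz
      rw [indicator_of_notMem]
      simp only [mem_inter_iff, mem_preimage, mem_singleton_iff, not_and]
      exact fun _ => hz.symm
    · simp
    · intro y _ hy
      refine Finset.sum_eq_zero fun z _ => ?_
      rw [indicator_of_notMem]
      simp only [mem_inter_iff, mem_preimage, mem_singleton_iff, not_and]
      exact fun h' => (hy h'.symm).elim
    · simp
  have hmeas : ∀ y z, MeasurableSet (g ⁻¹' {y} ∩ h ⁻¹' {z}) := fun y z =>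
    (g.measurableSet_fiber y).inter (h.measurableSet_fiber z)
  have hint : ∀ y z, Integrable ((g ⁻¹' {y} ∩ h ⁻¹' {z}).indicator (fun _ => y * z)) μ := by
    intro y z
    by_cases hy : y = 0
    · simp [hy]
    · rw [integrable_indicator_iff (hmeas y z), integrableOn_const_iff]
      exact Or.inr ((measure_mono inter_subset_left).trans_lt (measure_fiber_lt_top hg hy))
  have hint' : ∀ y z, Integrable
      (fun ω => (y * M (g ⁻¹' {y}) ω) * (z * M (h ⁻¹' {z}) ω)) P := fun y z =>
    (hM.memLp_mul_fiber hg y).integrable_mul (hM.memLp_mul_fiber hh z)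
  simp_rw [hl, hr]
  rw [integral_finsetSum _ fun y _ => integrable_finsetSum _ fun z _ => hint' y z,
    integral_finsetSum _ fun y _ => integrable_finsetSum _ fun z _ => hint y z]
  refine Finset.sum_congr rfl fun y _ => ?_
  rw [integral_finsetSum _ fun z _ => hint' y z,
    integral_finsetSum _ fun z _ => hint y z]
  refine Finset.sum_congr rfl fun z _ => ?_
  rw [integral_indicator_const _ (hmeas y z)]
  by_cases hy : y = 0
  · simp [hy]
  by_cases hz : z = 0
  · simp [hz]
  rw [← hM.integral_mul (g.measurableSet_fiber y) (measure_fiber_lt_top hg hy)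
    (h.measurableSet_fiber z) (measure_fiber_lt_top hh hz), smul_eq_mul, ← integral_mul_const]
  exact integral_congr_ae (ae_of_all _ fun ω => by ring)

lemma eLpNorm_simpleStochInt_sub [IsProbabilityMeasure P] {g h : SimpleFunc E ℝ}
    (hg : MemLp g 2 μ) (hh : MemLp h 2 μ) :
    eLpNorm (simpleStochInt M g - simpleStochInt M h) 2 P = eLpNorm (g - h : E → ℝ) 2 μ :=
  eLpNorm_sub_eq_of_integral_mul_eq (hM.memLp_simpleStochInt hg) (hM.memLp_simpleStochInt hh) hg hh
    (hM.integral_simpleStochInt_mul hg hg) (hM.integral_simpleStochInt_mul hg hh)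
    (hM.integral_simpleStochInt_mul hh hh)

/-- By the isometry the integrals of approximating simple functions are Cauchy in L²(P), which is
complete. -/
lemma exists_isStochInt [IsProbabilityMeasure P] {f : E → ℝ} (hf : MemLp f 2 μ) :
    ∃ X, IsStochInt M μ P f X := by
  have hε : ∀ n : ℕ, ((n : ℝ≥0∞) + 1)⁻¹ ≠ 0 := fun n => by simp
  choose g hg hg2 using fun n : ℕ => hf.exists_simpleFunc_eLpNorm_sub_lt (by norm_num) (hε n)
  have hlim : Tendsto (fun n => eLpNorm (f - ⇑(g n)) 2 μ) atTop (𝓝 0) := by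
    refine tendsto_of_tendsto_of_tendsto_of_le_of_le tendsto_const_nhds
      ((tendsto_add_atTop_iff_nat 1).2 ENNReal.tendsto_inv_nat_nhds_zero) (fun _ => zero_le)
      fun n => ?_
    simpa using (hg n).le
  have hlim' := hlim
  simp_rw [eLpNorm_sub_comm f] at hlim'
  rw [← Lp.tendsto_Lp_iff_tendsto_eLpNorm'' (fun n => ⇑(g n)) hg2 f hf] at hlim'
  have hc := hlim'.cauchySeq
  have hI := fun n => hM.memLp_simpleStochInt (hg2 n)
  have hc' : CauchySeq fun n => (hI n).toLp (simpleStochInt M (g n)) := by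
    rw [EMetric.cauchySeq_iff] at hc ⊢
    simpa only [Lp.edist_toLp_toLp, hM.eLpNorm_simpleStochInt_sub (hg2 _) (hg2 _)] using hc
  obtain ⟨X, hX⟩ := cauchySeq_tendsto_of_complete hc'
  refine ⟨X, hf, Lp.memLp X, g, hg2, hlim, ?_⟩
  have hXt : X = (Lp.memLp X).toLp X := (Lp.toLp_coeFn X _).symm
  rw [hXt, Lp.tendsto_Lp_iff_tendsto_eLpNorm'' (fun n => simpleStochInt M (g n)) hI X
    (Lp.memLp X)] at hX
  simp_rw [eLpNorm_sub_comm _ (X : Ω → ℝ)] at hX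
  exact hX

lemma isStochInt_stochInt [IsProbabilityMeasure P] {f : E → ℝ} (hf : MemLp f 2 μ) :
    IsStochInt M μ P f (stochInt M μ P f) := by
  have h := hM.exists_isStochInt hf
  rw [stochInt, dif_pos h]
  exact h.choose_spec

/-- The covariance structure of stochastic integrals. -/
lemma integral_mul_of_isStochInt [IsProbabilityMeasure P] {f h : E → ℝ} {X Y : Ω → ℝ}
    (hX : IsStochInt M μ P f X) (hY : IsStochInt M μ P h Y) :
    ∫ ω, X ω * Y ω ∂P = ∫ x, f x * h x ∂μ := by
  obtain ⟨hf, hX2, g, hg, hgf, hgX⟩ := hX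
  obtain ⟨hh, hY2, k, hk, hkh, hkY⟩ := hY
  have h1 := tendsto_integral_mul_of_tendsto_eLpNorm hX2 hY2
    (fun n => hM.memLp_simpleStochInt (hg n)) (fun n => hM.memLp_simpleStochInt (hk n)) hgX hkY
  have h2 := tendsto_integral_mul_of_tendsto_eLpNorm hf hh hg hk hgf hkh
  simp_rw [hM.integral_simpleStochInt_mul (hg _) (hk _)] at h1
  exact tendsto_nhds_unique h1 h2

lemma integral_of_isStochInt [IsProbabilityMeasure P] {f : E → ℝ} {X : Ω → ℝ}
    (hX : IsStochInt M μ P f X) : ∫ ω, X ω ∂P = 0 := by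
  obtain ⟨-, hX2, g, hg, -, hgX⟩ := hX
  have h1 := tendsto_integral_of_tendsto_eLpNorm_two hX2
    (fun n => hM.memLp_simpleStochInt (hg n)) hgX
  simp_rw [hM.integral_simpleStochInt (hg _)] at h1
  exact tendsto_nhds_unique h1 tendsto_const_nhds

lemma eLpNorm_sub_of_isStochInt [IsProbabilityMeasure P] {f h : E → ℝ} {X Y : Ω → ℝ}
    (hX : IsStochInt M μ P f X) (hY : IsStochInt M μ P h Y) :
    eLpNorm (X - Y) 2 P = eLpNorm (f - h) 2 μ :=
  eLpNorm_sub_eq_of_integral_mul_eq hX.2.1 hY.2.1 hX.1 hY.1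
    (hM.integral_mul_of_isStochInt hX hX) (hM.integral_mul_of_isStochInt hX hY)
    (hM.integral_mul_of_isStochInt hY hY)

lemma ae_eq_of_isStochInt [IsProbabilityMeasure P] {f : E → ℝ} {X Y : Ω → ℝ}
    (hX : IsStochInt M μ P f X) (hY : IsStochInt M μ P f Y) : X =ᵐ[P] Y := by
  have h := hM.eLpNorm_sub_of_isStochInt hX hY
  rw [sub_self, eLpNorm_zero, eLpNorm_eq_zero_iff (hX.2.1.sub hY.2.1).aestronglyMeasurable
    (by norm_num)] at h
  filter_upwards [h] with ω hω
  simpa [sub_eq_zero] using hω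

/-- Each integral is a fixed linear combination of finitely many `M A`; only the nonzero values of
the simple function are kept, so that every `A` has finite measure. -/
lemma isGaussianProcess_simpleStochInt :
    IsGaussianProcess (fun g : {g : SimpleFunc E ℝ // MemLp g 2 μ} => simpleStochInt M g.1) P := by
  classical
  refine hM.gaussian.of_isGaussianProcess fun ⟨g, hg⟩ => ?_
  let S : Finset ℝ := g.range.filter (· ≠ 0)
  have hS : ∀ y ∈ S, MeasurableSet (g ⁻¹' {y}) ∧ μ (g ⁻¹' {y}) < ∞ := fun y hy =>
    ⟨g.measurableSet_fiber y, measure_fiber_lt_top hg (Finset.mem_filter.1 hy).2⟩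
  let e : S → {A : Set E // MeasurableSet A ∧ μ A < ∞} := fun y => ⟨g ⁻¹' {y.1}, hS y y.2⟩
  let I : Finset {A : Set E // MeasurableSet A ∧ μ A < ∞} := Finset.univ.image e
  have hI : ∀ y, e y ∈ I := fun y => Finset.mem_image_of_mem _ (Finset.mem_univ y)
  let p : I → ((I → ℝ) →L[ℝ] ℝ) := fun i => ContinuousLinearMap.proj i
  refine ⟨I, ∑ y : S, (y : ℝ) • p ⟨e y, hI y⟩, fun ω => ?_⟩
  simp only [sum_apply, smul_apply, p,
    ContinuousLinearMap.proj_apply, Finset.restrict, e, smul_eq_mul]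
  rw [Finset.sum_coe_sort S (fun y => y * M (g ⁻¹' {y}) ω), simpleStochInt, Finset.sum_filter]
  refine Finset.sum_congr rfl fun y _ => ?_
  by_cases hy : y = 0 <;> simp [hy]

/-- Stochastic integrals with respect to a Gaussian random measure are jointly Gaussian. -/
lemma isGaussianProcess_of_isStochInt [IsProbabilityMeasure P] {T : Type*} {f : T → E → ℝ}
    {X : T → Ω → ℝ} (hX : ∀ t, IsStochInt M μ P (f t) (X t)) : IsGaussianProcess X P := by
  classical
  choose hf hX2 g hg hgf hgX using hX
  -- It suffices to test linear functionals `L` of finite subfamilies. Each is one linear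
  -- combination of the `X i`, hence an L² limit of the same combination of simple integrals.
  refine ⟨fun I => ⟨isGaussian_of_isGaussian_map fun L => ?_⟩⟩
  have hL : ∀ x : I → ℝ, L x = ∑ i, x i * L (Pi.single i 1) := by
    intro x
    conv_lhs => rw [← Finset.univ_sum_single x, map_sum]
    refine Finset.sum_congr rfl fun i _ => ?_
    rw [← smul_eq_mul, ← map_smul, ← Pi.single_smul]
    simp
  have hmeas : AEMeasurable (fun ω => I.restrict (X · ω)) P :=
    aemeasurable_pi_lambda _ fun i => (hX2 i).aestronglyMeasurable.aemeasurable
  rw [AEMeasurable.map_map_of_aemeasurable (by fun_prop) hmeas]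
  suffices h : HasGaussianLaw (L ∘ fun ω => I.restrict (X · ω)) P from h.isGaussian_map
  have hcomp : ∀ W : T → Ω → ℝ, (L ∘ fun ω => I.restrict (W · ω))
      = ∑ i : I, L (Pi.single i 1) • W i := by
    intro W
    ext ω
    simp [hL (I.restrict (W · ω)), mul_comm]
  have hmem : ∀ W : T → Ω → ℝ, (∀ t, MemLp (W t) 2 P) →
      MemLp (L ∘ fun ω => I.restrict (W · ω)) 2 P := by
    intro W hW
    rw [hcomp]
    exact memLp_finsetSum' _ fun i _ => (hW i).const_smul _
  refine HasGaussianLaw.of_tendsto_eLpNorm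
    (Xn := fun n => L ∘ fun ω => I.restrict (fun t => simpleStochInt M (g t n) ω))
    (hmem X hX2) (fun n => ?_) ?_
  · have h := (hM.isGaussianProcess_simpleStochInt.comp_right
      (fun t => ⟨g t n, hg t n⟩)).hasGaussianLaw I
    exact h.map L
  · have hb : Tendsto (fun n => ∑ i : I, ‖L (Pi.single i 1)‖ₑ *
        eLpNorm (X i - simpleStochInt M (g i n)) 2 P) atTop (𝓝 (∑ _i : I, 0)) := by
      refine tendsto_finsetSum _ fun i _ => ?_
      have h := ENNReal.Tendsto.const_mul (a := ‖L (Pi.single i 1)‖ₑ) (hgX i)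
        (Or.inr enorm_ne_top)
      rwa [mul_zero] at h
    rw [Finset.sum_const_zero] at hb
    refine tendsto_of_tendsto_of_tendsto_of_le_of_le tendsto_const_nhds hb (fun _ => zero_le)
      fun n => ?_
    simp only [hcomp X, hcomp (fun t => simpleStochInt M (g t n)), ← Finset.sum_sub_distrib,
      ← smul_sub]
    refine (eLpNorm_sum_le (fun i _ => ?_) (by norm_num)).trans
      (Finset.sum_le_sum fun i _ => (eLpNorm_const_smul _ _ _ _).le)
    exact (((hX2 i).sub (hM.memLp_simpleStochInt (hg i n))).const_smul _).aestronglyMeasurable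

end IsGaussianRandomMeasure

end StochInt

/-! ### Dyadic chaining for a single path -/

section DyadicChaining

/-- The largest dyadic number of level `n` that is at most `t`. -/
noncomputable def dyadicFloor (n : ℕ) (t : ℝ≥0) : ℝ≥0 := (⌊t * 2 ^ n⌋₊ : ℝ≥0) / 2 ^ n

lemma dyadicFloor_le (n : ℕ) (t : ℝ≥0) : dyadicFloor n t ≤ t := by
  rw [dyadicFloor, div_le_iff₀ (by positivity)]
  exact Nat.floor_le (by positivity)

lemma lt_dyadicFloor_add (n : ℕ) (t : ℝ≥0) : t < dyadicFloor n t + (2 ^ n)⁻¹ := by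
  rw [dyadicFloor, div_eq_mul_inv, ← add_one_mul, ← div_eq_mul_inv, lt_div_iff₀ (by positivity)]
  exact Nat.lt_floor_add_one _

lemma floor_mul_two_pow_lt {t : ℝ≥0} {T : ℕ} (ht : t < T) (n : ℕ) :
    ⌊t * 2 ^ n⌋₊ < T * 2 ^ n := by
  rw [Nat.floor_lt (by positivity)]
  push_cast
  gcongr

variable {f : ℝ≥0 → ℝ} {C ρ : ℝ} {T : ℕ}

/-- With `m` the integer part at level `n + 1`, the integer part at level `n` is `m / 2`. So the two
dyadic floors coincide (`m` even) or differ by one step of level `n + 1` (`m` odd). -/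
lemma dist_dyadicFloor_succ_le (hC : 0 ≤ C) (hρ : 0 ≤ ρ)
    (hf : ∀ n k : ℕ, k < T * 2 ^ n → |f ((k + 1 : ℕ) / 2 ^ n) - f (k / 2 ^ n)| ≤ C * ρ ^ n)
    {t : ℝ≥0} (ht : t < T) (n : ℕ) :
    dist (f (dyadicFloor n t)) (f (dyadicFloor (n + 1) t)) ≤ C * ρ * ρ ^ n := by
  have hm := floor_mul_two_pow_lt ht (n + 1)
  have hk : ⌊t * 2 ^ n⌋₊ = ⌊t * 2 ^ (n + 1)⌋₊ / 2 := by
    rw [← Nat.floor_div_ofNat, pow_succ, ← mul_assoc, mul_div_assoc]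
    norm_num
  unfold dyadicFloor
  rw [hk]
  set m := ⌊t * 2 ^ (n + 1)⌋₊
  have hh : ((m / 2 : ℕ) : ℝ≥0) / 2 ^ n = ((2 * (m / 2) : ℕ) : ℝ≥0) / 2 ^ (n + 1) := by
    rw [pow_succ]
    push_cast
    field_simp
  rw [hh, dist_comm, Real.dist_eq]
  rcases Nat.mod_two_eq_zero_or_one m with h | h
  · have : 2 * (m / 2) = m := by lia
    rw [this, sub_self, abs_zero]
    positivity
  · have h1 : m = 2 * (m / 2) + 1 := by lia
    have h2 := hf (n + 1) (2 * (m / 2)) (by lia)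
    rw [← h1] at h2
    exact h2.trans_eq (by ring)

lemma abs_sub_le_of_dyadic_steps
    (hf : ∀ n k : ℕ, k < T * 2 ^ n → |f ((k + 1 : ℕ) / 2 ^ n) - f (k / 2 ^ n)| ≤ C * ρ ^ n)
    (n k j : ℕ) (hkj : k + j ≤ T * 2 ^ n) :
    |f ((k + j : ℕ) / 2 ^ n) - f (k / 2 ^ n)| ≤ j * (C * ρ ^ n) := by
  induction j with
  | zero => simp
  | succ j ih =>
    have h1 := ih (by lia)
    have h2 := hf n (k + j) (by lia)
    have h3 := abs_sub_le (f ((k + j + 1 : ℕ) / 2 ^ n)) (f ((k + j : ℕ) / 2 ^ n)) (f (k / 2 ^ n))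
    rw [← add_assoc]
    push_cast at *
    linarith

/-- The first bound limits the number of level-`n` steps across a gap `d`; the second makes the
errors at level `n` comparable with `d`. If `d ≥ 1`, level `0` serves, whence the `max`. -/
lemma exists_dyadic_scale {d : ℝ} (hd : 0 < d) :
    ∃ n : ℕ, 2 ^ n * d ≤ max 1 d ∧ ((2 : ℝ)⁻¹) ^ n ≤ 2 * d := by
  rcases le_total 1 d with h | h
  · exact ⟨0, by simp, by simp; linarith⟩
  · obtain ⟨n, hn1, hn2⟩ := exists_nat_pow_near_of_lt_one (y := (2 : ℝ)⁻¹) hd h (by norm_num)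
      (by norm_num)
    refine ⟨n, le_max_of_le_left ?_, ?_⟩
    · calc (2 : ℝ) ^ n * d ≤ 2 ^ n * (2⁻¹) ^ n := by gcongr
        _ = 1 := by rw [← mul_pow]; norm_num
    · rw [pow_succ] at hn1
      linarith

/-- Geometric bounds on the increments over neighbouring dyadic numbers make the values along
dyadic approximations converge to a Hölder continuous function. -/
lemma exists_holderOnWith_of_dyadic_steps (hC : 0 ≤ C) {γ : ℝ≥0} (hγ : 0 < γ)
    (hf : ∀ n k : ℕ, k < T * 2 ^ n →
      |f ((k + 1 : ℕ) / 2 ^ n) - f (k / 2 ^ n)| ≤ C * (((2 : ℝ)⁻¹) ^ (γ : ℝ)) ^ n)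
    {g : ℝ≥0 → ℝ}
    (hg : ∀ t : ℝ≥0, t < T → Tendsto (fun n => f (dyadicFloor n t)) atTop (𝓝 (g t))) :
    ∃ K : ℝ≥0, HolderOnWith K γ g (Iio (T : ℝ≥0)) := by
  set ρ : ℝ := ((2 : ℝ)⁻¹) ^ (γ : ℝ) with hρdef
  have hρ0 : 0 ≤ ρ := by positivity
  have hρ1 : ρ < 1 := Real.rpow_lt_one (by norm_num) (by norm_num) (by exact_mod_cast hγ)
  have hstep : ∀ t : ℝ≥0, t < T → ∀ n,
      dist (f (dyadicFloor n t)) (g t) ≤ C * ρ * ρ ^ n / (1 - ρ) := fun t ht n =>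
    dist_le_of_le_geometric_of_tendsto ρ (C * ρ) hρ1
      (dist_dyadicFloor_succ_le hC hρ0 hf ht) (hg t ht) n
  -- Two geometric tails, from the level-`n` floors of `s` and `t` to the limits, plus at most `T +
  -- 2` steps of level `n` between these floors. The factor `2 ^ γ` comes from `2⁻ⁿ ≤ 2 * d`.
  set K : ℝ := (2 * (C * ρ / (1 - ρ)) + (T + 2) * C) * 2 ^ (γ : ℝ) with hK
  have hK0 : 0 ≤ K := by
    have : 0 < 1 - ρ := by linarith
    positivity
  have key : ∀ s t : ℝ≥0, s < t → t < T → dist (g s) (g t) ≤ K * dist s t ^ (γ : ℝ) := by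
    intro s t hst ht
    set d : ℝ := (t : ℝ) - s with hd
    have hd0 : 0 < d := sub_pos.2 hst
    have hdist : dist s t = d := by
      rw [NNReal.dist_eq, abs_sub_comm, abs_of_pos hd0]
    obtain ⟨n, hn1, hn2⟩ := exists_dyadic_scale hd0
    have htT : (t : ℝ) < T := by exact_mod_cast ht
    have hdT : d ≤ T := by linarith [s.2]
    have hn1' : 2 ^ n * d ≤ T + 1 := hn1.trans (max_le (by linarith) (by linarith))
    have hρn : ρ ^ n ≤ 2 ^ (γ : ℝ) * d ^ (γ : ℝ) := by
      rw [← Real.mul_rpow (by norm_num) hd0.le, hρdef, ← Real.rpow_natCast, ← Real.rpow_mul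
        (by norm_num), mul_comm, Real.rpow_mul (by norm_num), Real.rpow_natCast]
      exact Real.rpow_le_rpow (by positivity) hn2 γ.2
    obtain ⟨j, hj⟩ := Nat.exists_eq_add_of_le
      (Nat.floor_mono (mul_le_mul_left hst.le (2 ^ n)) : ⌊s * 2 ^ n⌋₊ ≤ ⌊t * 2 ^ n⌋₊)
    have hjle : (j : ℝ) ≤ T + 2 := by
      have h1 : ((⌊t * 2 ^ n⌋₊ : ℝ≥0) : ℝ) ≤ (t * 2 ^ n : ℝ≥0) := by
        exact_mod_cast Nat.floor_le (by positivity)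
      have h2 : ((s * 2 ^ n : ℝ≥0) : ℝ) < (⌊s * 2 ^ n⌋₊ : ℝ≥0) + 1 := by
        exact_mod_cast Nat.lt_floor_add_one (s * 2 ^ n)
      rw [hj] at h1
      push_cast at h1 h2
      nlinarith
    have h1 := hstep s (hst.trans ht) n
    have h2 := hstep t ht n
    have h3 : dist (f (dyadicFloor n s)) (f (dyadicFloor n t)) ≤ (T + 2) * (C * ρ ^ n) := by
      have := abs_sub_le_of_dyadic_steps hf n ⌊s * 2 ^ n⌋₊ j
        (hj ▸ (floor_mul_two_pow_lt ht n).le)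
      rw [← hj] at this
      rw [dist_comm, Real.dist_eq]
      refine this.trans ?_
      gcongr
    have h4 := dist_triangle4 (g s) (f (dyadicFloor n s)) (f (dyadicFloor n t)) (g t)
    rw [dist_comm (g s) (f _)] at h4
    rw [hdist]
    calc dist (g s) (g t) ≤ (2 * (C * ρ / (1 - ρ)) + (T + 2) * C) * ρ ^ n := by
          refine h4.trans ((add_le_add (add_le_add h1 h3) h2).trans (le_of_eq ?_))
          ring
      _ ≤ (2 * (C * ρ / (1 - ρ)) + (T + 2) * C) * (2 ^ (γ : ℝ) * d ^ (γ : ℝ)) := by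
          have : 0 < 1 - ρ := by linarith
          gcongr
      _ = K * d ^ (γ : ℝ) := by rw [hK]; ring
  refine ⟨K.toNNReal, fun s hs t ht => ?_⟩
  have hdist : dist (g s) (g t) ≤ K * dist s t ^ (γ : ℝ) := by
    rcases lt_trichotomy s t with h | h | h
    · exact key s t h ht
    · rw [h, dist_self]
      positivity
    · rw [dist_comm, dist_comm s]
      exact key t s h hs
  rw [edist_dist, edist_dist, ENNReal.ofReal_rpow_of_nonneg dist_nonneg γ.coe_nonneg]
  change _ ≤ ENNReal.ofReal K * _
  rw [← ENNReal.ofReal_mul hK0]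
  exact ENNReal.ofReal_le_ofReal hdist

lemma exists_tendsto_dyadicFloor_of_dyadic_steps (hC : 0 ≤ C) {γ : ℝ≥0} (hγ : 0 < γ)
    (hf : ∀ n k : ℕ, k < T * 2 ^ n →
      |f ((k + 1 : ℕ) / 2 ^ n) - f (k / 2 ^ n)| ≤ C * (((2 : ℝ)⁻¹) ^ (γ : ℝ)) ^ n)
    {t : ℝ≥0} (ht : t < T) : ∃ x, Tendsto (fun n => f (dyadicFloor n t)) atTop (𝓝 x) :=
  cauchySeq_tendsto_of_complete <| cauchySeq_of_le_geometric _ _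
    (Real.rpow_lt_one (by norm_num) (by norm_num) (by exact_mod_cast hγ))
    (dist_dyadicFloor_succ_le hC (by positivity) hf ht)

end DyadicChaining

/-! ### The Kolmogorov–Chentsov theorem -/

section KolmogorovChentsov

variable {Ω : Type*} {X : ℝ≥0 → Ω → ℝ}

/-- The sum over all levels of the `q`-th powers of the rescaled dyadic increments on `[0, T]`. -/
noncomputable def dyadicIncrementSum (X : ℝ≥0 → Ω → ℝ) (γ : ℝ≥0) (q T : ℕ) (ω : Ω) : ℝ≥0∞ :=
  ∑' n : ℕ, ∑ k ∈ Finset.range (T * 2 ^ n),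
    (((2 : ℝ≥0∞) ^ (γ : ℝ)) ^ n * ‖X ((k + 1 : ℕ) / 2 ^ n) ω - X (k / 2 ^ n) ω‖ₑ) ^ q

/-- Each term of a nonnegative series is at most its sum; its `q`-th root is a constant valid at all
levels. -/
lemma exists_dyadic_step_bound {γ : ℝ≥0} {q T : ℕ} (hq : q ≠ 0) {ω : Ω}
    (hω : dyadicIncrementSum X γ q T ω < ∞) :
    ∃ C : ℝ, 0 ≤ C ∧ ∀ n k : ℕ, k < T * 2 ^ n →
      |X ((k + 1 : ℕ) / 2 ^ n) ω - X (k / 2 ^ n) ω| ≤ C * (((2 : ℝ)⁻¹) ^ (γ : ℝ)) ^ n := by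
  set S := dyadicIncrementSum X γ q T ω with hS
  refine ⟨(S ^ (q : ℝ)⁻¹).toReal, ENNReal.toReal_nonneg, fun n k hk => ?_⟩
  have h1 : (((2 : ℝ≥0∞) ^ (γ : ℝ)) ^ n * ‖X ((k + 1 : ℕ) / 2 ^ n) ω - X (k / 2 ^ n) ω‖ₑ) ^ q
      ≤ S :=
    (Finset.single_le_sum (f := fun k : ℕ => (((2 : ℝ≥0∞) ^ (γ : ℝ)) ^ n *
      ‖X ((k + 1 : ℕ) / 2 ^ n) ω - X (k / 2 ^ n) ω‖ₑ) ^ q) (fun _ _ => zero_le)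
      (Finset.mem_range.2 hk)).trans (ENNReal.le_tsum n)
  rw [← ENNReal.rpow_natCast, ← ENNReal.le_rpow_inv_iff (by positivity)] at h1
  have h2 := ENNReal.toReal_mono (ENNReal.rpow_ne_top_of_nonneg (by positivity) hω.ne) h1
  rw [ENNReal.toReal_mul, ENNReal.toReal_pow, ← ENNReal.toReal_rpow, toReal_enorm,
    Real.norm_eq_abs, ENNReal.toReal_ofNat] at h2
  rw [Real.inv_rpow (by norm_num), inv_pow, ← div_eq_mul_inv, le_div_iff₀ (by positivity),
    mul_comm]
  exact h2

variable [MeasurableSpace Ω] {P : Measure Ω}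

lemma measurable_dyadicIncrementSum (hX : ∀ t, Measurable (X t)) (γ : ℝ≥0) (q T : ℕ) :
    Measurable (dyadicIncrementSum X γ q T) := by
  unfold dyadicIncrementSum
  refine Measurable.tsum fun n => Finset.measurable_fun_sum _ fun k _ => ?_
  have h1 := hX ((k + 1 : ℕ) / 2 ^ n)
  have h2 := hX (k / 2 ^ n)
  fun_prop

/-- Level `n` has `T * 2 ^ n` increments of length `2⁻ⁿ`, so it contributes at most `T * K * r ^ n`
with `r = 2 ^ (1 - q * (H - γ))`, and `hq` says that `r < 1`. -/
lemma lintegral_dyadicIncrementSum_lt_top (hX : ∀ t, Measurable (X t)) {γ : ℝ≥0} {q : ℕ} {H : ℝ}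
    (T : ℕ) {K : ℝ≥0}
    (hK : ∀ s t, ∫⁻ ω, ‖X t ω - X s ω‖ₑ ^ q ∂P ≤ K * edist t s ^ (q * H))
    (hq : 1 < q * (H - γ)) :
    ∫⁻ ω, dyadicIncrementSum X γ q T ω ∂P < ∞ := by
  have hinc : ∀ n k : ℕ, edist (((k + 1 : ℕ) : ℝ≥0) / 2 ^ n) (k / 2 ^ n) = (2 : ℝ≥0∞)⁻¹ ^ n := by
    intro n k
    have h1 : (((k + 1 : ℕ) : ℝ≥0) / 2 ^ n) = k / 2 ^ n + (2⁻¹) ^ n := by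
      rw [inv_pow, div_eq_mul_inv, div_eq_mul_inv]
      push_cast
      ring
    rw [h1, edist_nndist, NNReal.nndist_eq, add_tsub_cancel_left, tsub_eq_zero_of_le (by simp),
      max_eq_left (by simp)]
    simp [ENNReal.coe_inv, ENNReal.inv_pow]
  set r : ℝ≥0∞ := 2 ^ (1 - q * (H - γ)) with hr
  have hr1 : r < 1 := ENNReal.rpow_lt_one_of_one_lt_of_neg (by norm_num) (by linarith)
  have hterm : ∀ n k : ℕ, ∫⁻ ω, (((2 : ℝ≥0∞) ^ (γ : ℝ)) ^ n *
      ‖X ((k + 1 : ℕ) / 2 ^ n) ω - X (k / 2 ^ n) ω‖ₑ) ^ q ∂P ≤ K * ((2 : ℝ≥0∞)⁻¹ * r) ^ n := by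
    intro n k
    simp_rw [mul_pow _ _ q]
    have h1 := hX ((k + 1 : ℕ) / 2 ^ n)
    have h2 := hX (k / 2 ^ n)
    rw [lintegral_const_mul _ (by fun_prop)]
    refine (mul_le_mul_right (hK _ _) _).trans (le_of_eq ?_)
    rw [hinc, mul_left_comm]
    congr 1
    have h2 : (2 : ℝ≥0∞) ≠ 0 := by norm_num
    have h2' : (2 : ℝ≥0∞) ≠ ∞ := by norm_num
    rw [hr, ← ENNReal.rpow_neg_one, ← ENNReal.rpow_add _ _ h2 h2', ← ENNReal.rpow_natCast,
      ← ENNReal.rpow_natCast, ← ENNReal.rpow_natCast, ← ENNReal.rpow_natCast, ← ENNReal.rpow_mul,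
      ← ENNReal.rpow_mul, ← ENNReal.rpow_mul, ← ENNReal.rpow_mul, ← ENNReal.rpow_mul,
      ← ENNReal.rpow_add _ _ h2 h2']
    congr 1
    ring
  unfold dyadicIncrementSum
  rw [lintegral_tsum]
  · calc ∑' n : ℕ, ∫⁻ ω, ∑ k ∈ Finset.range (T * 2 ^ n), (((2 : ℝ≥0∞) ^ (γ : ℝ)) ^ n *
          ‖X ((k + 1 : ℕ) / 2 ^ n) ω - X (k / 2 ^ n) ω‖ₑ) ^ q ∂P
        ≤ ∑' n : ℕ, T * K * r ^ n := by
          refine ENNReal.tsum_le_tsum fun n => ?_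
          rw [lintegral_finsetSum]
          · refine (Finset.sum_le_sum fun k _ => hterm n k).trans (le_of_eq ?_)
            rw [Finset.sum_const, Finset.card_range, nsmul_eq_mul, mul_pow]
            push_cast
            calc (T : ℝ≥0∞) * 2 ^ n * (K * (2⁻¹ ^ n * r ^ n))
                = T * K * r ^ n * (2 ^ n * 2⁻¹ ^ n) := by ring
              _ = T * K * r ^ n := by
                rw [← mul_pow, ENNReal.mul_inv_cancel (by norm_num) (by norm_num), one_pow,
                  mul_one]
          · intro k _
            have h1 := hX ((k + 1 : ℕ) / 2 ^ n)
            have h2 := hX (k / 2 ^ n)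
            fun_prop
      _ < ∞ := by
          rw [ENNReal.tsum_mul_left, ENNReal.tsum_geometric]
          refine ENNReal.mul_lt_top (ENNReal.mul_lt_top (by simp) (by simp)) ?_
          rw [ENNReal.inv_lt_top]
          exact tsub_pos_of_lt hr1
  · intro n
    refine (Finset.measurable_fun_sum _ fun k _ => ?_).aemeasurable
    have h1 := hX ((k + 1 : ℕ) / 2 ^ n)
    have h2 := hX (k / 2 ^ n)
    fun_prop

/-- **Kolmogorov–Chentsov**: a process on `[0, ∞)` with increments whose moments of all even orders
scale like those of an `H`-self-similar process has a modification that is locally Hölder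
continuous of every order less than `H`. -/
theorem exists_modification_holder [IsFiniteMeasure P] (hX : ∀ t, Measurable (X t)) {H : ℝ}
    (hH : 0 < H)
    (hmom : ∀ p : ℕ, ∃ K : ℝ≥0, ∀ s t,
      ∫⁻ ω, ‖X t ω - X s ω‖ₑ ^ (2 * p) ∂P ≤ K * edist t s ^ ((2 * p : ℕ) * H)) :
    ∃ Y : ℝ≥0 → Ω → ℝ, (∀ t, Measurable (Y t)) ∧ (∀ t, Y t =ᵐ[P] X t) ∧
      ∀ γ : ℝ≥0, 0 < γ → (γ : ℝ) < H → ∀ ω, ∀ T : ℝ≥0,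
        ∃ K : ℝ≥0, HolderOnWith K γ (fun t => Y t ω) (Icc 0 T) := by
  classical
  -- Countably many exponents increasing to `H` cover all `γ < H`, so a single null set is
  -- discarded.
  obtain ⟨u, -, huH, hu⟩ := exists_seq_strictMono_tendsto' hH
  have hexp : ∀ j, ∃ p : ℕ, 1 < (2 * p : ℕ) * (H - u j) := by
    intro j
    obtain ⟨p, hp⟩ := exists_nat_gt (1 / (H - u j))
    have hj : 0 < H - u j := sub_pos.2 (huH j).2
    rw [div_lt_iff₀ hj] at hp
    refine ⟨p, ?_⟩
    push_cast
    nlinarith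
  choose p hp using hexp
  let g : ℕ → ℝ≥0 := fun j => (u j).toNNReal
  have hg : ∀ j, (g j : ℝ) = u j := fun j => Real.coe_toNNReal _ (huH j).1.le
  have hg0 : ∀ j, 0 < g j := fun j => by
    rw [← NNReal.coe_pos, hg]
    exact (huH j).1
  let G : Set Ω := ⋂ j, ⋂ T : ℕ, {ω | dyadicIncrementSum X (g j) (2 * p j) T ω < ∞}
  have hGm : MeasurableSet G := MeasurableSet.iInter fun j => MeasurableSet.iInter fun T =>
    measurableSet_lt (measurable_dyadicIncrementSum hX _ _ _) measurable_const
  have hGae : ∀ᵐ ω ∂P, ω ∈ G := by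
    simp only [G, mem_iInter, mem_ofPred_eq]
    refine ae_all_iff.2 fun j => ae_all_iff.2 fun T => ?_
    obtain ⟨K, hK⟩ := hmom (p j)
    refine ae_lt_top (measurable_dyadicIncrementSum hX _ _ _)
      (lintegral_dyadicIncrementSum_lt_top hX T hK ?_).ne
    rw [hg]
    exact hp j
  have hp0 : ∀ j, 2 * p j ≠ 0 := by
    intro j h
    have := hp j
    rw [h] at this
    norm_num at this
  have hstep : ∀ ω ∈ G, ∀ (j T : ℕ), ∃ C : ℝ, 0 ≤ C ∧ ∀ n k : ℕ, k < T * 2 ^ n →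
      |X ((k + 1 : ℕ) / 2 ^ n) ω - X (k / 2 ^ n) ω| ≤ C * (((2 : ℝ)⁻¹) ^ (g j : ℝ)) ^ n := by
    intro ω hω j T
    simp only [G, mem_iInter, mem_ofPred_eq] at hω
    exact exists_dyadic_step_bound (hp0 j) (hω j T)
  -- The indicator makes `Y` vanish identically off `G`, so that every path is Hölder, not just
  -- almost every one.
  have hlim : ∀ t ω, ∃ y, Tendsto (fun n => G.indicator (X (dyadicFloor n t)) ω) atTop (𝓝 y) := by
    intro t ω
    by_cases hω : ω ∈ G
    · obtain ⟨T, hT⟩ := exists_nat_gt t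
      obtain ⟨C, hC, h⟩ := hstep ω hω 0 T
      obtain ⟨y, hy⟩ :=
        exists_tendsto_dyadicFloor_of_dyadic_steps (f := fun t => X t ω) hC (hg0 0) h hT
      exact ⟨y, by simpa [indicator_of_mem hω] using hy⟩
    · exact ⟨0, by simp [indicator_of_notMem hω]⟩
  choose Y hY using hlim
  have hYm : ∀ t, Measurable (Y t) := fun t =>
    measurable_of_tendsto_metrizable (fun n => (hX (dyadicFloor n t)).indicator hGm)
      (tendsto_pi_nhds.2 (hY t))
  refine ⟨Y, hYm, fun t => ?_, fun γ hγ hγH ω T => ?_⟩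
  -- Along dyadic floors `X` tends to `Y t` almost surely and to `X t` in L², by the second-moment
  -- bound; limits in measure are almost surely unique.
  · have h1 : TendstoInMeasure P (fun n => X (dyadicFloor n t)) atTop (Y t) := by
      refine tendstoInMeasure_of_tendsto_ae (fun n => (hX _).aestronglyMeasurable) ?_
      filter_upwards [hGae] with ω hω
      simpa [indicator_of_mem hω] using hY t ω
    have h2 : TendstoInMeasure P (fun n => X (dyadicFloor n t)) atTop (X t) := by
      refine tendstoInMeasure_of_tendsto_eLpNorm (p := 2) (by norm_num)
        (fun n => (hX _).aestronglyMeasurable) (hX t).aestronglyMeasurable ?_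
      obtain ⟨K, hK⟩ := hmom 1
      have hd : Tendsto (fun n => edist (dyadicFloor n t) t) atTop (𝓝 0) := by
        refine tendsto_of_tendsto_of_tendsto_of_le_of_le tendsto_const_nhds
          (ENNReal.tendsto_pow_atTop_nhds_zero_of_lt_one (r := 2⁻¹) (by norm_num))
          (fun _ => zero_le) fun n => ?_
        rw [edist_comm, edist_nndist, NNReal.nndist_eq,
          tsub_eq_zero_of_le (dyadicFloor_le n t), max_eq_left (by simp)]
        have h3 : ((2 : ℝ≥0∞)⁻¹) ^ n = (((2 ^ n)⁻¹ : ℝ≥0) : ℝ≥0∞) := by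
          simp [ENNReal.coe_inv, ENNReal.inv_pow]
        rw [h3, ENNReal.coe_le_coe, tsub_le_iff_left]
        exact (lt_dyadicFloor_add n t).le
      have hb : Tendsto (fun n => (K * edist (dyadicFloor n t) t ^ ((2 * 1 : ℕ) * H)) ^
          (1 / 2 : ℝ)) atTop (𝓝 0) := by
        have h3 := ((ENNReal.continuous_rpow_const (y := (2 * 1 : ℕ) * H)).tendsto _).comp hd
        rw [ENNReal.zero_rpow_of_pos (by positivity)] at h3
        have h4 := ENNReal.Tendsto.const_mul (a := (K : ℝ≥0∞)) h3 (Or.inr (by simp))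
        have h5 := ((ENNReal.continuous_rpow_const (y := (1 / 2 : ℝ))).tendsto _).comp h4
        rw [mul_zero, ENNReal.zero_rpow_of_pos (by norm_num)] at h5
        exact h5
      refine tendsto_of_tendsto_of_tendsto_of_le_of_le tendsto_const_nhds hb (fun _ => zero_le)
        fun n => ?_
      rw [eLpNorm_eq_lintegral_rpow_enorm_toReal (by norm_num) (by norm_num)]
      refine ENNReal.rpow_le_rpow ?_ (by norm_num)
      refine (lintegral_congr fun ω => ?_).trans_le (hK t (dyadicFloor n t))
      exact ENNReal.rpow_natCast _ 2
    exact tendstoInMeasure_ae_unique h1 h2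
  · by_cases hω : ω ∈ G
    -- On a bounded set, Hölder continuity of order `u j > γ` implies that of order `γ`.
    · obtain ⟨j, hj⟩ := (hu.eventually (lt_mem_nhds hγH)).exists
      obtain ⟨m, hm⟩ := exists_nat_gt T
      obtain ⟨C, hC, h⟩ := hstep ω hω j m
      obtain ⟨K, hK⟩ := exists_holderOnWith_of_dyadic_steps (f := fun t => X t ω) hC (hg0 j) h
        (g := fun t => Y t ω) (fun t _ => by simpa [indicator_of_mem hω] using hY t ω)
      refine ⟨_, (hK.mono fun t ht => lt_of_le_of_lt ht.2 hm).of_le (D := T)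
        (fun x hx y hy => ?_) ?_⟩
      · rw [edist_nndist, ENNReal.coe_le_coe, NNReal.nndist_eq]
        exact max_le (tsub_le_self.trans hx.2) (tsub_le_self.trans hy.2)
      · rw [← NNReal.coe_le_coe, hg]
        exact hj.le
    · have h0 : ∀ t, Y t ω = 0 := fun t =>
        tendsto_nhds_unique (hY t ω) (by simp [indicator_of_notMem hω])
      refine ⟨0, fun x _ y _ => ?_⟩
      simp [h0]

end KolmogorovChentsov

/-! ### Fractional moments of the Poisson law -/

section PoissonMoments

/-- `k ^ p` for `k ≥ 1`, and `0` for `k = 0` (also when `p = 0`). -/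
noncomputable def natPow (p : ℝ) (k : ℕ) : ℝ := if k = 0 then 0 else (k : ℝ) ^ p

lemma natPow_le_self {p : ℝ} (hp : p ≤ 1) (k : ℕ) : natPow p k ≤ k := by
  unfold natPow
  split_ifs with h
  · simp
  · have : (1 : ℝ) ≤ k := by exact_mod_cast Nat.one_le_iff_ne_zero.2 h
    simpa using Real.rpow_le_rpow_of_exponent_le this hp

/-- If `k ≤ r`, the first term suffices. Otherwise `k ^ p = k ^ (p - 1) * k`, and the first factor
decreases in `k`. The bound is affine in `k`, with Poisson mean `2 * r ^ p`. -/
lemma natPow_le_add {p r : ℝ} (hp0 : 0 ≤ p) (hp : p ≤ 1) (hr : 0 < r) (k : ℕ) :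
    natPow p k ≤ r ^ p + r ^ (p - 1) * k := by
  unfold natPow
  split_ifs with h
  · positivity
  · have hk : (0 : ℝ) < k := by exact_mod_cast Nat.pos_of_ne_zero h
    rcases le_total (k : ℝ) r with hkr | hkr
    · have := Real.rpow_le_rpow hk.le hkr hp0
      have : 0 ≤ r ^ (p - 1) * (k : ℝ) := by positivity
      linarith
    · have h1 : (k : ℝ) ^ p = k ^ (p - 1) * k := by
        rw [Real.rpow_sub_one hk.ne']
        field_simp
      have h2 : (k : ℝ) ^ (p - 1) ≤ r ^ (p - 1) :=
        Real.rpow_le_rpow_of_nonpos hr hkr (by linarith)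
      have h3 : 0 ≤ r ^ p := by positivity
      rw [h1]
      nlinarith

lemma lintegral_poissonMeasure (r : ℝ≥0) (f : ℕ → ℝ≥0∞) :
    ∫⁻ k, f k ∂poissonMeasure r
      = ∑' k : ℕ, ENNReal.ofReal (Real.exp (-r) * r ^ k / (k ! : ℝ)) * f k := by
  rw [poissonMeasure, lintegral_sum_measure]
  simp

lemma lintegral_natCast_poissonMeasure (r : ℝ≥0) :
    ∫⁻ k, (k : ℝ≥0∞) ∂poissonMeasure r = r := by
  rw [lintegral_poissonMeasure, tsum_eq_zero_add' ENNReal.summable]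
  have h : ∀ k : ℕ, ENNReal.ofReal (Real.exp (-r) * r ^ (k + 1) / ((k + 1)! : ℝ)) *
      ((k + 1 : ℕ) : ℝ≥0∞) = r * ENNReal.ofReal (Real.exp (-r) * r ^ k / (k ! : ℝ)) := by
    intro k
    rw [← ENNReal.ofReal_natCast, ← ENNReal.ofReal_coe_nnreal,
      ← ENNReal.ofReal_mul (by positivity), ← ENNReal.ofReal_mul (by positivity)]
    congr 1
    rw [Nat.factorial_succ, pow_succ]
    push_cast
    field_simp
  simp_rw [h]
  rw [ENNReal.tsum_mul_left]
  have h1 := lintegral_poissonMeasure r (fun _ => 1)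
  simp only [lintegral_const, measure_univ, mul_one] at h1
  rw [← h1]
  simp

/-- The bound that matters for small `r`. It relies on `natPow p 0 = 0`, even for `p = 0`. -/
lemma lintegral_natPow_poissonMeasure_le_self {p : ℝ} (hp : p ≤ 1) (r : ℝ≥0) :
    ∫⁻ k, ENNReal.ofReal (natPow p k) ∂poissonMeasure r ≤ ENNReal.ofReal r := by
  rw [ENNReal.ofReal_coe_nnreal, ← lintegral_natCast_poissonMeasure r]
  refine lintegral_mono fun k => ?_
  rw [← ENNReal.ofReal_natCast]
  exact ENNReal.ofReal_le_ofReal (natPow_le_self hp k)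

lemma lintegral_natPow_poissonMeasure_le_rpow {p : ℝ} (hp0 : 0 ≤ p) (hp : p ≤ 1) {r : ℝ≥0}
    (hr : 0 < r) :
    ∫⁻ k, ENNReal.ofReal (natPow p k) ∂poissonMeasure r
      ≤ ENNReal.ofReal (2 * (r : ℝ) ^ p) := by
  have hr' : (0 : ℝ) < r := hr
  calc ∫⁻ k, ENNReal.ofReal (natPow p k) ∂poissonMeasure r
      ≤ ∫⁻ k : ℕ, (ENNReal.ofReal ((r : ℝ) ^ p) + ENNReal.ofReal ((r : ℝ) ^ (p - 1)) * k)
          ∂poissonMeasure r := by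
        refine lintegral_mono fun k => ?_
        rw [← ENNReal.ofReal_natCast, ← ENNReal.ofReal_mul (by positivity),
          ← ENNReal.ofReal_add (by positivity) (by positivity)]
        exact ENNReal.ofReal_le_ofReal (natPow_le_add hp0 hp hr' k)
    _ = ENNReal.ofReal (2 * (r : ℝ) ^ p) := by
        rw [lintegral_add_left (by fun_prop), lintegral_const_mul _ (by fun_prop),
          lintegral_natCast_poissonMeasure, lintegral_const, measure_univ, mul_one,
          ← ENNReal.ofReal_coe_nnreal, ← ENNReal.ofReal_mul (by positivity),
          ← ENNReal.ofReal_add (by positivity) (by positivity), Real.rpow_sub_one hr'.ne']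
        congr 1
        field_simp
        ring

end PoissonMoments

/-! ### Integration against the radial measure -/

section RadialMeasure

instance (α : ℝ) : SFinite (radialMeasure α) := by
  unfold radialMeasure
  infer_instance

lemma lintegral_radialMeasure (α : ℝ) {f : ℝ≥0 → ℝ≥0∞} (hf : Measurable f) :
    ∫⁻ r, f r ∂radialMeasure α
      = ∫⁻ r in Ioi (0 : ℝ), ENNReal.ofReal (α * r ^ (-α - 1)) * f r.toNNReal := by
  unfold radialMeasure
  rw [lintegral_map hf (by fun_prop), lintegral_withDensity_eq_lintegral_mul _ (by fun_prop)
    (by fun_prop)]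
  rfl

lemma ae_radialMeasure_pos (α : ℝ) : ∀ᵐ r ∂radialMeasure α, 0 < r := by
  unfold radialMeasure
  rw [ae_map_iff (by fun_prop) (measurableSet_Ioi : MeasurableSet {r : ℝ≥0 | 0 < r})]
  refine withDensity_absolutelyContinuous _ _ ?_
  filter_upwards [ae_restrict_mem measurableSet_Ioi] with r hr
  exact Real.toNNReal_pos.2 hr

lemma lintegral_Ioc_rpow_near_zero {α h : ℝ} (hα0 : 0 < α) (hα1 : α < 1) (hh : 0 < h) :
    ∫⁻ r in Ioc (0 : ℝ) h⁻¹, ENNReal.ofReal (α * r ^ (-α - 1)) * ENNReal.ofReal (r * h)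
      = ENNReal.ofReal (α / (1 - α) * h ^ α) := by
  have hc : 0 < h⁻¹ := by positivity
  have h1 : ∀ r ∈ Ioc (0 : ℝ) h⁻¹,
      ENNReal.ofReal (α * r ^ (-α - 1)) * ENNReal.ofReal (r * h)
        = ENNReal.ofReal (α * h * r ^ (-α)) := by
    intro r hr
    have := hr.1
    rw [← ENNReal.ofReal_mul (by positivity), Real.rpow_sub_one this.ne']
    congr 1
    field_simp
  rw [setLIntegral_congr_fun measurableSet_Ioc h1]
  have hint : IntervalIntegrable (fun r : ℝ => α * h * r ^ (-α)) volume 0 h⁻¹ :=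
    (intervalIntegral.intervalIntegrable_rpow' (by linarith)).const_mul _
  rw [intervalIntegrable_iff_integrableOn_Ioc_of_le hc.le] at hint
  rw [← ofReal_integral_eq_lintegral_ofReal hint, ← intervalIntegral.integral_of_le hc.le,
    intervalIntegral.integral_const_mul, integral_rpow (Or.inl (by linarith))]
  · congr 1
    rw [Real.zero_rpow (by linarith), Real.inv_rpow hh.le, ← Real.rpow_neg hh.le]
    have h2 : h ^ α = h * h ^ (-(-α + 1)) := by
      rw [← Real.rpow_one_add' hh.le (by linarith)]
      ring_nf
    rw [h2]
    have : 1 - α ≠ 0 := by linarith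
    have : -α + 1 ≠ 0 := by linarith
    field_simp
    ring
  · filter_upwards [ae_restrict_mem measurableSet_Ioc] with r hr
    have := hr.1
    positivity

lemma lintegral_Ioi_rpow_near_infty {α h p : ℝ} (hα0 : 0 < α) (hh : 0 < h) (hp : p < α) :
    ∫⁻ r in Ioi h⁻¹, ENNReal.ofReal (α * r ^ (-α - 1)) * ENNReal.ofReal (2 * (r * h) ^ p)
      = ENNReal.ofReal (2 * α / (α - p) * h ^ α) := by
  have hc : 0 < h⁻¹ := by positivity
  have h1 : ∀ r ∈ Ioi h⁻¹,
      ENNReal.ofReal (α * r ^ (-α - 1)) * ENNReal.ofReal (2 * (r * h) ^ p)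
        = ENNReal.ofReal (2 * α * h ^ p * r ^ (p - α - 1)) := by
    intro r hr
    have hr0 : 0 < r := hc.trans hr
    rw [← ENNReal.ofReal_mul (by positivity), Real.mul_rpow hr0.le hh.le]
    congr 1
    have : r ^ (p - α - 1) = r ^ (-α - 1) * r ^ p := by
      rw [← Real.rpow_add hr0]
      ring_nf
    rw [this]
    ring
  rw [setLIntegral_congr_fun measurableSet_Ioi h1]
  have hint : IntegrableOn (fun r : ℝ => 2 * α * h ^ p * r ^ (p - α - 1)) (Ioi h⁻¹) :=
    (integrableOn_Ioi_rpow_of_lt (by linarith) hc).const_mul _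
  rw [← ofReal_integral_eq_lintegral_ofReal hint, integral_const_mul,
    integral_Ioi_rpow_of_lt (by linarith) hc]
  · congr 1
    rw [Real.inv_rpow hh.le, ← Real.rpow_neg hh.le]
    have h2 : h ^ α = h ^ p * h ^ (-(p - α - 1 + 1)) := by
      rw [← Real.rpow_add hh]
      ring_nf
    rw [h2]
    have : α - p ≠ 0 := by linarith
    have h3 : p - α - 1 + 1 = -(α - p) := by ring
    rw [h3]
    field_simp
  · filter_upwards [ae_restrict_mem measurableSet_Ioi] with r hr
    have : 0 < r := hc.trans hr
    positivity

/-- The constant in the moment bounds for the intensity measure. -/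
noncomputable def radialConst (α p : ℝ) : ℝ := α / (1 - α) + 2 * α / (α - p)

lemma radialConst_nonneg {α p : ℝ} (hα0 : 0 < α) (hα1 : α < 1) (hp : p < α) :
    0 ≤ radialConst α p := by
  have : 0 < 1 - α := by linarith
  have : 0 < α - p := by linarith
  unfold radialConst
  positivity

/-- Split at `r = h⁻¹`: the linear bound is integrable below because `α < 1`, the power bound above
because `p < α`, and both parts scale like `h ^ α`. -/
lemma lintegral_radialMeasure_le {α p : ℝ} (hα0 : 0 < α) (hα1 : α < 1) (hp : p < α) (h : ℝ≥0)
    {m : ℝ≥0 → ℝ≥0∞} (hm1 : ∀ r, m r ≤ ENNReal.ofReal r)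
    (hm2 : ∀ r : ℝ≥0, 0 < r → m r ≤ ENNReal.ofReal (2 * (r : ℝ) ^ p)) :
    ∫⁻ r, m (r * h) ∂radialMeasure α ≤ ENNReal.ofReal (radialConst α p * (h : ℝ) ^ α) := by
  rcases eq_or_ne h 0 with rfl | hh
  · have : m 0 = 0 := by simpa using hm1 0
    simp [this]
  have hh0 : (0 : ℝ) < h := by positivity
  have h1α : 0 < 1 - α := by linarith
  have hpα : 0 < α - p := by linarith
  -- `m` is not assumed measurable; the minimum of its two bounds is.
  let m' : ℝ≥0 → ℝ≥0∞ := fun r =>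
    min (ENNReal.ofReal (r * h : ℝ)) (ENNReal.ofReal (2 * (r * h : ℝ) ^ p))
  have hm' : Measurable m' := by
    simp only [m']
    fun_prop
  calc ∫⁻ r, m (r * h) ∂radialMeasure α ≤ ∫⁻ r, m' r ∂radialMeasure α := by
        refine lintegral_mono_ae ?_
        filter_upwards [ae_radialMeasure_pos α] with r hr
        refine le_min ?_ ?_
        · exact_mod_cast hm1 (r * h)
        · exact_mod_cast hm2 (r * h) (by positivity)
    _ = ∫⁻ r in Ioi (0 : ℝ), ENNReal.ofReal (α * r ^ (-α - 1)) * m' r.toNNReal :=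
        lintegral_radialMeasure α hm'
    _ ≤ (∫⁻ r in Ioc (0 : ℝ) (h : ℝ)⁻¹, ENNReal.ofReal (α * r ^ (-α - 1)) * m' r.toNNReal) +
        ∫⁻ r in Ioi (h : ℝ)⁻¹, ENNReal.ofReal (α * r ^ (-α - 1)) * m' r.toNNReal := by
        rw [← Ioc_union_Ioi_eq_Ioi (inv_nonneg.2 hh0.le)]
        exact lintegral_union_le _ _ _
    _ ≤ (∫⁻ r in Ioc (0 : ℝ) (h : ℝ)⁻¹,
          ENNReal.ofReal (α * r ^ (-α - 1)) * ENNReal.ofReal (r * h)) +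
        ∫⁻ r in Ioi (h : ℝ)⁻¹,
          ENNReal.ofReal (α * r ^ (-α - 1)) * ENNReal.ofReal (2 * (r * h) ^ p) := by
        refine add_le_add (setLIntegral_mono' measurableSet_Ioc fun r hr => ?_)
          (setLIntegral_mono' measurableSet_Ioi fun r hr => ?_)
        · gcongr
          refine (min_le_left _ _).trans (le_of_eq ?_)
          rw [Real.coe_toNNReal _ hr.1.le]
        · gcongr
          refine (min_le_right _ _).trans (le_of_eq ?_)
          rw [Real.coe_toNNReal _ ((inv_pos.2 hh0).trans hr).le]
    _ = ENNReal.ofReal (radialConst α p * (h : ℝ) ^ α) := by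
        rw [lintegral_Ioc_rpow_near_zero hα0 hα1 hh0, lintegral_Ioi_rpow_near_infty hα0 hh0 hp,
          ← ENNReal.ofReal_add (by positivity) (by positivity), radialConst, add_mul]

end RadialMeasure

/-! ### The time-changed Poisson process -/

section PoissonProcess

variable {Ω' : Type*} [MeasurableSpace Ω'] {P' : Measure Ω'} {N : ℝ≥0 → Ω' → ℕ}

namespace IsStandardPoissonProcess

variable (hN : IsStandardPoissonProcess N P')

include hN

lemma hasLaw (t : ℝ≥0) : HasLaw (N t) (poissonMeasure t) P' := by
  have h := hN.law 0 t zero_le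
  rw [tsub_zero] at h
  refine h.congr ?_
  filter_upwards [hN.zero_ae] with ω hω
  simp [hω]

lemma hasLaw_prodMk_increment [IsProbabilityMeasure P'] {s t : ℝ≥0} (hst : s ≤ t) :
    HasLaw (fun ω => (N s ω, N t ω - N s ω)) ((poissonMeasure s).prod (poissonMeasure (t - s)))
      P' := by
  -- Almost surely `N s` is the increment over `[0, s]`, since `N 0 = 0`.
  have hind : (N s) ⟂ᵢ[P'] (fun ω => N t ω - N s ω) := by
    refine (hN.indep.indepFun_sub_sub (zero_le : 0 ≤ s) hst).congr ?_ (ae_eq_refl _)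
    filter_upwards [hN.zero_ae] with ω hω
    simp [hω]
  have hs := hN.measurable s
  have ht := hN.measurable t
  refine ⟨by fun_prop, ?_⟩
  rw [(indepFun_iff_map_prod_eq_prod_map_map (by fun_prop) (by fun_prop)).1 hind,
    (hN.hasLaw s).map_eq, (hN.law s t hst).map_eq]

lemma ae_add_increment {s t : ℝ≥0} (hst : s ≤ t) :
    ∀ᵐ ω ∂P', N s ω + (N t ω - N s ω) = N t ω := by
  filter_upwards [hN.paths] with ω hω
  exact Nat.add_sub_cancel' (hω.1 hst)

/-- A Poisson process agrees, outside of a null set, with a jointly measurable process. -/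
lemma exists_jointly_measurable :
    ∃ N' : ℝ≥0 × Ω' → ℕ, Measurable N' ∧ ∀ᵐ ω ∂P', ∀ u, N u ω = N' (u, ω) := by
  obtain ⟨G, hG, hGm, hGp⟩ := hN.paths.exists_measurable_mem
  refine ⟨fun x => G.indicator (N x.1) x.2, ?_, ?_⟩
  -- Evaluate at the first level-`n` dyadic time strictly after `x.1`: only countably many times
  -- occur, which gives joint measurability, and right-continuity gives convergence.
  · let A : ℕ → ℝ≥0 × Ω' → ℕ := fun n x =>
      G.indicator (N (((⌊x.1 * 2 ^ n⌋₊ + 1 : ℕ) : ℝ≥0) / 2 ^ n)) x.2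
    have hA : ∀ n, Measurable (A n) := by
      intro n
      have h1 : Measurable (fun y : ℕ × Ω' =>
          G.indicator (N (((y.1 + 1 : ℕ) : ℝ≥0) / 2 ^ n)) y.2) :=
        measurable_from_prod_countable_right fun k =>
          (hN.measurable (((k + 1 : ℕ) : ℝ≥0) / 2 ^ n)).indicator hGm
      have h2 : Measurable (fun x : ℝ≥0 × Ω' => (⌊x.1 * 2 ^ n⌋₊, x.2)) :=
        (Nat.measurable_floor.comp (measurable_fst.mul_const _)).prodMk measurable_snd
      exact h1.comp h2
    refine measurable_of_tendsto_metrizable hA (tendsto_pi_nhds.2 fun x => ?_)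
    by_cases hx : x.2 ∈ G
    · simp only [A, indicator_of_mem hx]
      have hc := (hGp x.2 hx).2 x.1
      refine hc.tendsto.comp (tendsto_nhdsWithin_iff.2 ⟨?_, Eventually.of_forall fun n => ?_⟩)
      · refine tendsto_of_tendsto_of_tendsto_of_le_of_le (g := fun _ => x.1)
          (h := fun n : ℕ => x.1 + 2⁻¹ ^ n) tendsto_const_nhds ?_ (fun n => ?_) (fun n => ?_)
        · have := (tendsto_pow_atTop_nhds_zero_of_lt_one (r := (2 : ℝ≥0)⁻¹) zero_le
            (by rw [inv_lt_one₀] <;> norm_num)).const_add x.1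
          simpa using this
        · simp only
          rw [le_div_iff₀ (by positivity)]
          push_cast
          exact (Nat.lt_floor_add_one _).le
        · simp only
          push_cast
          rw [add_div, inv_pow, one_div]
          exact add_le_add_left (dyadicFloor_le n x.1) _
      · simp only [mem_Ici]
        rw [le_div_iff₀ (by positivity)]
        push_cast
        exact (Nat.lt_floor_add_one _).le
    · simp [A, indicator_of_notMem hx]
  · filter_upwards [hG] with ω hω u
    simp [indicator_of_mem hω]

lemma aemeasurable_time_change [SFinite P'] {ρ : Measure ℝ≥0} [SFinite ρ] (t : ℝ≥0) :
    AEMeasurable (fun x : ℝ≥0 × Ω' => N (x.1 * t) x.2) (ρ.prod P') := by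
  obtain ⟨N', hN', hae⟩ := hN.exists_jointly_measurable
  refine ⟨fun x => N' (x.1 * t, x.2), hN'.comp (by fun_prop), ?_⟩
  filter_upwards [Measure.quasiMeasurePreserving_snd.ae hae] with x hx
  exact hx _

/-- By Tonelli the inner integral at `r` is a moment of the Poisson law of parameter `r * (t - s)`,
so the radial bound applies with `h = t - s`. -/
lemma lintegral_intensity_natPow_increment_le [IsProbabilityMeasure P'] {α p : ℝ} (hα0 : 0 < α)
    (hα1 : α < 1) (hp0 : 0 ≤ p) (hp : p < α) {s t : ℝ≥0} (hst : s ≤ t) :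
    ∫⁻ x, ENNReal.ofReal (natPow p (N (x.1 * t) x.2 - N (x.1 * s) x.2)) ∂intensity α P'
      ≤ ENNReal.ofReal (radialConst α p * ((t - s : ℝ≥0) : ℝ) ^ α) := by
  unfold intensity
  have hm : AEMeasurable (fun x : ℝ≥0 × Ω' => ENNReal.ofReal
      (natPow p (N (x.1 * t) x.2 - N (x.1 * s) x.2))) ((radialMeasure α).prod P') :=
    (Measurable.of_discrete (f := fun k : ℕ × ℕ =>
      ENNReal.ofReal (natPow p (k.1 - k.2)))).comp_aemeasurable
      ((hN.aemeasurable_time_change t).prodMk (hN.aemeasurable_time_change s))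
  rw [lintegral_prod _ hm]
  have h : ∀ r : ℝ≥0, ∫⁻ ω, ENNReal.ofReal (natPow p (N (r * t) ω - N (r * s) ω)) ∂P'
      = ∫⁻ k, ENNReal.ofReal (natPow p k) ∂poissonMeasure (r * (t - s)) := by
    intro r
    have hlaw := hN.law (r * s) (r * t) (by gcongr)
    rw [← mul_tsub] at hlaw
    exact hlaw.lintegral_comp (f := fun k => ENNReal.ofReal (natPow p k)) (by fun_prop)
  simp_rw [h]
  exact lintegral_radialMeasure_le hα0 hα1 hp (t - s)
    (m := fun r => ∫⁻ k, ENNReal.ofReal (natPow p k) ∂poissonMeasure r)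
    (lintegral_natPow_poissonMeasure_le_self (by linarith))
    (fun r hr => lintegral_natPow_poissonMeasure_le_rpow hp0 (by linarith) hr)

end IsStandardPoissonProcess

lemma ae_intensity_of_ae {α : ℝ} {p : Ω' → Prop} (h : ∀ᵐ ω ∂P', p ω) :
    ∀ᵐ x ∂intensity α P', p x.2 :=
  Measure.quasiMeasurePreserving_snd.ae h

end PoissonProcess

/-! ### Centering in L² -/

section Centering

variable {S Ω' : Type*} [MeasurableSpace S] [MeasurableSpace Ω'] {ρ : Measure S} {P' : Measure Ω'}

/-- Averaging over the second variable is a contraction in `L²`. -/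
lemma eLpNorm_integral_prod_le [SFinite ρ] [IsProbabilityMeasure P'] {W : S × Ω' → ℝ}
    (hW : MemLp W 2 (ρ.prod P')) :
    MemLp (fun x : S × Ω' => ∫ ω, W (x.1, ω) ∂P') 2 (ρ.prod P') ∧
      eLpNorm (fun x : S × Ω' => ∫ ω, W (x.1, ω) ∂P') 2 (ρ.prod P')
        ≤ eLpNorm W 2 (ρ.prod P') := by
  have hm : AEStronglyMeasurable (fun r => ∫ ω, W (r, ω) ∂P') ρ :=
    hW.aestronglyMeasurable.integral_prod_right'
  have hm2 : AEStronglyMeasurable (fun x : S × Ω' => ∫ ω, W (x.1, ω) ∂P') (ρ.prod P') :=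
    hm.comp_fst
  have hle : eLpNorm (fun x : S × Ω' => ∫ ω, W (x.1, ω) ∂P') 2 (ρ.prod P')
      ≤ eLpNorm W 2 (ρ.prod P') := by
    rw [eLpNorm_eq_lintegral_rpow_enorm_toReal (by norm_num) (by norm_num),
      eLpNorm_eq_lintegral_rpow_enorm_toReal (by norm_num) (by norm_num)]
    refine ENNReal.rpow_le_rpow ?_ (by norm_num)
    rw [lintegral_prod _ (by fun_prop), lintegral_prod _ (by have := hW.1; fun_prop)]
    refine lintegral_mono_ae ?_
    filter_upwards [hW.aestronglyMeasurable.prodMk_left] with r hr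
    rw [lintegral_const, measure_univ, mul_one]
    have h1 : ‖∫ ω, W (r, ω) ∂P'‖ₑ ≤ eLpNorm (fun ω => W (r, ω)) 2 P' := by
      refine (enorm_integral_le_lintegral_enorm _).trans ?_
      rw [← eLpNorm_one_eq_lintegral_enorm]
      exact eLpNorm_le_eLpNorm_of_exponent_le (by norm_num) hr
    rw [eLpNorm_eq_lintegral_rpow_enorm_toReal (by norm_num) (by norm_num)] at h1
    refine (ENNReal.rpow_le_rpow h1 (by norm_num)).trans (le_of_eq ?_)
    rw [← ENNReal.rpow_mul]
    norm_num
  exact ⟨⟨hm2, hle.trans_lt hW.2⟩, hle⟩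

lemma memLp_sub_integral_prod [SFinite ρ] [IsProbabilityMeasure P'] {W : S × Ω' → ℝ}
    (hW : MemLp W 2 (ρ.prod P')) :
    MemLp (fun x : S × Ω' => W x - ∫ ω, W (x.1, ω) ∂P') 2 (ρ.prod P') :=
  hW.sub (eLpNorm_integral_prod_le hW).1

lemma eLpNorm_sub_integral_prod_le [SFinite ρ] [IsProbabilityMeasure P'] {W : S × Ω' → ℝ}
    (hW : MemLp W 2 (ρ.prod P')) :
    eLpNorm (fun x : S × Ω' => W x - ∫ ω, W (x.1, ω) ∂P') 2 (ρ.prod P')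
      ≤ 2 * eLpNorm W 2 (ρ.prod P') := by
  obtain ⟨h1, h2⟩ := eLpNorm_integral_prod_le hW
  refine (eLpNorm_sub_le hW.1 h1.1 (by norm_num)).trans ?_
  rw [two_mul]
  exact add_le_add_right h2 _

end Centering

/-! ### L² bounds for the kernels -/

section KernelMoments

variable {Ω' : Type*} [MeasurableSpace Ω'] {P' : Measure Ω'} {N : ℝ≥0 → Ω' → ℕ} {a : ℕ → ℝ}

lemma enorm_sq_le_natPow {x C β : ℝ} {j : ℕ} (hj : 1 ≤ j) (hx : |x| ≤ C * (j : ℝ) ^ β) :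
    ‖x‖ₑ ^ 2 ≤ ENNReal.ofReal (C ^ 2) * ENNReal.ofReal (natPow (2 * β) j) := by
  rw [Real.enorm_eq_ofReal_abs, ← ENNReal.ofReal_pow (abs_nonneg x),
    ← ENNReal.ofReal_mul (sq_nonneg C), natPow, if_neg (by lia)]
  refine ENNReal.ofReal_le_ofReal ((pow_le_pow_left₀ (abs_nonneg x) hx 2).trans (le_of_eq ?_))
  rw [mul_pow, ← Real.rpow_natCast ((j : ℝ) ^ β), ← Real.rpow_mul (by positivity)]
  push_cast
  rw [mul_comm β]

lemma enorm_sq_le_natPow_of_growth (ha0 : a 0 = 0) {C β : ℝ}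
    (ha : ∀ j : ℕ, 1 ≤ j → |a j| ≤ C * (j : ℝ) ^ β) (j : ℕ) :
    ‖a j‖ₑ ^ 2 ≤ ENNReal.ofReal (C ^ 2) * ENNReal.ofReal (natPow (2 * β) j) := by
  rcases Nat.eq_zero_or_pos j with rfl | hj
  · simp [ha0]
  · exact enorm_sq_le_natPow hj (ha j hj)

lemma enorm_sub_sq_le_natPow_of_increments {C β : ℝ}
    (ha : ∀ i j : ℕ, 1 ≤ j → |a (i + j) - a i| ≤ C * (j : ℝ) ^ β) (i j : ℕ) :
    ‖a (i + j) - a i‖ₑ ^ 2 ≤ ENNReal.ofReal (C ^ 2) * ENNReal.ofReal (natPow (2 * β) j) := by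
  rcases Nat.eq_zero_or_pos j with rfl | hj
  · simp
  · exact enorm_sq_le_natPow hj (ha i j hj)

namespace IsStandardPoissonProcess

variable (hN : IsStandardPoissonProcess N P')

include hN

lemma memLp_of_growth (ha0 : a 0 = 0) {C β : ℝ} (hβ : 2 * β ≤ 1)
    (ha : ∀ j : ℕ, 1 ≤ j → |a j| ≤ C * (j : ℝ) ^ β) (t : ℝ≥0) :
    MemLp (fun ω => a (N t ω)) 2 P' := by
  have hm : Measurable (fun ω => a (N t ω)) := Measurable.of_discrete.comp (hN.measurable t)
  refine ⟨hm.aestronglyMeasurable, ?_⟩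
  rw [eLpNorm_lt_top_iff_lintegral_rpow_enorm_lt_top (by norm_num) (by norm_num)]
  calc ∫⁻ ω, ‖a (N t ω)‖ₑ ^ (2 : ℝ≥0∞).toReal ∂P'
      = ∫⁻ ω, ‖a (N t ω)‖ₑ ^ 2 ∂P' := by
        refine lintegral_congr fun ω => ?_
        exact ENNReal.rpow_natCast _ 2
    _ ≤ ∫⁻ ω, ENNReal.ofReal (C ^ 2) * ENNReal.ofReal (natPow (2 * β) (N t ω)) ∂P' :=
        lintegral_mono fun ω => enorm_sq_le_natPow_of_growth ha0 ha _
    _ = ENNReal.ofReal (C ^ 2) *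
        ∫⁻ k, ENNReal.ofReal (natPow (2 * β) k) ∂poissonMeasure t := by
        rw [lintegral_const_mul' _ _ (by simp)]
        rw [(hN.hasLaw t).lintegral_comp (f := fun k => ENNReal.ofReal (natPow (2 * β) k))
          (by fun_prop)]
    _ < ∞ := ENNReal.mul_lt_top (by simp)
        ((lintegral_natPow_poissonMeasure_le_self hβ t).trans_lt (by simp))

variable [IsProbabilityMeasure P']

lemma aestronglyMeasurable_time_change {α : ℝ} (a : ℕ → ℝ) (t : ℝ≥0) :
    AEStronglyMeasurable (fun x : ℝ≥0 × Ω' => a (N (x.1 * t) x.2)) (intensity α P') :=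
  ((Measurable.of_discrete (f := a)).comp_aemeasurable
    (hN.aemeasurable_time_change t)).aestronglyMeasurable

lemma eLpNorm_le_of_natPow_increment {α p : ℝ} (hα0 : 0 < α) (hα1 : α < 1) (hp0 : 0 ≤ p)
    (hp : p < α) {s t : ℝ≥0} (hst : s ≤ t) {W : ℝ≥0 × Ω' → ℝ} {D : ℝ} (hD : 0 ≤ D)
    (hW : ∀ᵐ x ∂intensity α P', ‖W x‖ₑ ^ 2
      ≤ ENNReal.ofReal D * ENNReal.ofReal (natPow p (N (x.1 * t) x.2 - N (x.1 * s) x.2))) :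
    eLpNorm W 2 (intensity α P')
      ≤ ENNReal.ofReal (D * radialConst α p * ((t - s : ℝ≥0) : ℝ) ^ α) ^ (1 / 2 : ℝ) := by
  rw [eLpNorm_eq_lintegral_rpow_enorm_toReal (by norm_num) (by norm_num)]
  refine ENNReal.rpow_le_rpow ?_ (by norm_num)
  calc ∫⁻ x, ‖W x‖ₑ ^ (2 : ℝ≥0∞).toReal ∂intensity α P'
      = ∫⁻ x, ‖W x‖ₑ ^ 2 ∂intensity α P' := by
        refine lintegral_congr fun x => ?_
        exact ENNReal.rpow_natCast _ 2
    _ ≤ ∫⁻ x, ENNReal.ofReal D *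
          ENNReal.ofReal (natPow p (N (x.1 * t) x.2 - N (x.1 * s) x.2)) ∂intensity α P' :=
        lintegral_mono_ae hW
    _ ≤ ENNReal.ofReal (D * radialConst α p * ((t - s : ℝ≥0) : ℝ) ^ α) := by
        rw [lintegral_const_mul' _ _ (by simp), mul_assoc, ENNReal.ofReal_mul hD]
        gcongr
        exact hN.lintegral_intensity_natPow_increment_le hα0 hα1 hp0 hp hst

lemma memLp_time_change_of_growth (ha0 : a 0 = 0) {α C β : ℝ} (hα0 : 0 < α) (hα1 : α < 1)
    (hβ0 : 0 ≤ β) (hβ : β < α / 2) (ha : ∀ j : ℕ, 1 ≤ j → |a j| ≤ C * (j : ℝ) ^ β) (t : ℝ≥0) :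
    MemLp (fun x : ℝ≥0 × Ω' => a (N (x.1 * t) x.2)) 2 (intensity α P') := by
  refine ⟨hN.aestronglyMeasurable_time_change a t, ?_⟩
  refine (hN.eLpNorm_le_of_natPow_increment (p := 2 * β) (D := C ^ 2) hα0 hα1 (by linarith)
    (by linarith) (zero_le : 0 ≤ t) (sq_nonneg C) ?_).trans_lt
    (ENNReal.rpow_lt_top_of_nonneg (by norm_num) (by simp))
  filter_upwards [ae_intensity_of_ae hN.zero_ae] with x hx
  rw [mul_zero, hx, tsub_zero]
  exact enorm_sq_le_natPow_of_growth ha0 ha _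

lemma memLp_zKernel (ha0 : a 0 = 0) {α C β : ℝ} (hα0 : 0 < α) (hα1 : α < 1)
    (hβ0 : 0 ≤ β) (hβ : β < α / 2) (ha : ∀ j : ℕ, 1 ≤ j → |a j| ≤ C * (j : ℝ) ^ β) (t : ℝ≥0) :
    MemLp (zKernel a N P' t) 2 (intensity α P') :=
  memLp_sub_integral_prod (hN.memLp_time_change_of_growth ha0 hα0 hα1 hβ0 hβ ha t)

/-- On monotone paths the increment bound for `a` applies with `i = N(rs)` and `j = N(rt) - N(rs)`.
Centering at most doubles the norm. -/
lemma eLpNorm_zKernel_sub_le {α C β : ℝ} (hα0 : 0 < α) (hα1 : α < 1)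
    (hβ0 : 0 ≤ β) (hβ : β < α / 2) (hint : ∀ t, Integrable (fun ω => a (N t ω)) P')
    (ha : ∀ i j : ℕ, 1 ≤ j → |a (i + j) - a i| ≤ C * (j : ℝ) ^ β) {s t : ℝ≥0} (hst : s ≤ t) :
    eLpNorm (zKernel a N P' t - zKernel a N P' s) 2 (intensity α P')
      ≤ 2 * ENNReal.ofReal (C ^ 2 * radialConst α (2 * β) * ((t - s : ℝ≥0) : ℝ) ^ α)
        ^ (1 / 2 : ℝ) := by
  let W : ℝ≥0 × Ω' → ℝ := fun x => a (N (x.1 * t) x.2) - a (N (x.1 * s) x.2)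
  have hWb : eLpNorm W 2 (intensity α P') ≤ ENNReal.ofReal
      (C ^ 2 * radialConst α (2 * β) * ((t - s : ℝ≥0) : ℝ) ^ α) ^ (1 / 2 : ℝ) := by
    refine hN.eLpNorm_le_of_natPow_increment hα0 hα1 (by linarith) (by linarith) hst
      (sq_nonneg C) ?_
    filter_upwards [ae_intensity_of_ae hN.paths] with x hx
    have h := enorm_sub_sq_le_natPow_of_increments ha (N (x.1 * s) x.2)
      (N (x.1 * t) x.2 - N (x.1 * s) x.2)
    rwa [Nat.add_sub_cancel' (hx.1 (by gcongr))] at h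
  have hWm : MemLp W 2 (intensity α P') :=
    ⟨(hN.aestronglyMeasurable_time_change a t).sub (hN.aestronglyMeasurable_time_change a s),
      hWb.trans_lt (ENNReal.rpow_lt_top_of_nonneg (by norm_num) (by simp))⟩
  have heq : zKernel a N P' t - zKernel a N P' s
      = fun x => W x - ∫ ω, W (x.1, ω) ∂P' := by
    ext x
    simp only [Pi.sub_apply, zKernel, W]
    rw [integral_sub (hint _) (hint _)]
    ring
  rw [heq]
  exact (eLpNorm_sub_integral_prod_le hWm).trans (mul_le_mul_right hWb 2)

end IsStandardPoissonProcess

end KernelMoments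

/-! ### Series for functions of two independent Poisson variables -/

section PoissonSeries

/-- The average of `b` over the splittings `i + j = k` of `k` points into two classes that are
chosen independently with probabilities proportional to `x` and `y`. -/
noncomputable def binomAverage (b : ℕ × ℕ → ℝ) (x y : ℝ) (k : ℕ) : ℝ :=
  ∑ ij ∈ Finset.HasAntidiagonal.antidiagonal k,
    (k.choose ij.1 : ℝ) * (x / (x + y)) ^ ij.1 * (y / (x + y)) ^ ij.2 * b ij

lemma binomAverage_zero (b : ℕ × ℕ → ℝ) (x y : ℝ) : binomAverage b x y 0 = b (0, 0) := by
  simp [binomAverage]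

/-- This invariance frees the binomial averages from `r`: only the Poisson weight of the total
remains to be integrated. -/
lemma binomAverage_mul_left (b : ℕ × ℕ → ℝ) {r : ℝ} (hr : r ≠ 0) (x y : ℝ) (k : ℕ) :
    binomAverage b (r * x) (r * y) k = binomAverage b x y k := by
  unfold binomAverage
  rw [← mul_add, mul_div_mul_left _ _ hr, mul_div_mul_left _ _ hr]

lemma abs_binomAverage_le (b : ℕ × ℕ → ℝ) {x y : ℝ} (hx : 0 ≤ x) (hy : 0 ≤ y) (k : ℕ) :
    |binomAverage b x y k| ≤ binomAverage (fun ij => |b ij|) x y k := by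
  unfold binomAverage
  refine (Finset.abs_sum_le_sum_abs _ _).trans (Finset.sum_le_sum fun ij _ => ?_)
  rw [abs_mul, abs_of_nonneg (by positivity)]

lemma binomAverage_nonneg {b : ℕ × ℕ → ℝ} (hb : ∀ ij, 0 ≤ b ij) {x y : ℝ} (hx : 0 ≤ x)
    (hy : 0 ≤ y) (k : ℕ) : 0 ≤ binomAverage b x y k :=
  Finset.sum_nonneg fun ij _ => mul_nonneg (by positivity) (hb ij)

/-- The probability that a Poisson variable of parameter `u` equals `k`. -/
noncomputable def poissonWeight (u : ℝ) (k : ℕ) : ℝ := Real.exp (-u) * u ^ k / (k ! : ℝ)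

lemma poissonWeight_nonneg {u : ℝ} (hu : 0 ≤ u) (k : ℕ) : 0 ≤ poissonWeight u k := by
  unfold poissonWeight
  positivity

/-- Poisson splitting: given the total of two independent Poisson variables, the first is binomial
with success probability `x / (x + y)`. -/
lemma poissonWeight_mul_poissonWeight {x y : ℝ} (hxy : x + y ≠ 0) (i j : ℕ) :
    poissonWeight x i * poissonWeight y j
      = poissonWeight (x + y) (i + j) *
        (((i + j).choose i : ℝ) * (x / (x + y)) ^ i * (y / (x + y)) ^ j) := by
  have h : ((i + j).choose i : ℝ) * (i ! : ℝ) * (j ! : ℝ) = ((i + j)! : ℝ) := by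
    rw [← Nat.add_choose_mul_factorial_mul_factorial i j, Nat.choose_symm_add]
    push_cast
    rfl
  unfold poissonWeight
  rw [← h, neg_add, Real.exp_add, pow_add, div_pow, div_pow]
  have hc : ((i + j).choose i : ℝ) ≠ 0 := by
    exact_mod_cast (Nat.choose_pos (Nat.le_add_right i j)).ne'
  field_simp

lemma poissonMeasure_prod_real_singleton (x y : ℝ≥0) (ij : ℕ × ℕ) :
    ((poissonMeasure x).prod (poissonMeasure y)).real {ij}
      = poissonWeight x ij.1 * poissonWeight y ij.2 := by
  rw [← Prod.mk.eta (p := ij), ← singleton_prod_singleton, measureReal_prod_prod,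
    poissonMeasure_real_singleton, poissonMeasure_real_singleton, poissonWeight, poissonWeight]

lemma sum_antidiagonal_poissonWeight (b : ℕ × ℕ → ℝ) {x y : ℝ} (hxy : x + y ≠ 0) (k : ℕ) :
    ∑ ij ∈ Finset.HasAntidiagonal.antidiagonal k, (poissonWeight x ij.1 * poissonWeight y ij.2) * b ij
      = poissonWeight (x + y) k * binomAverage b x y k := by
  rw [binomAverage, Finset.mul_sum]
  refine Finset.sum_congr rfl fun ij hij => ?_
  rw [poissonWeight_mul_poissonWeight hxy, Finset.HasAntidiagonal.mem_antidiagonal.1 hij]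
  ring

lemma iUnion_antidiagonal_eq_univ :
    ⋃ k : ℕ, (↑(Finset.HasAntidiagonal.antidiagonal k) : Set (ℕ × ℕ)) = univ :=
  eq_univ_of_forall fun ij => mem_iUnion.2 ⟨ij.1 + ij.2, by simp⟩

lemma pairwise_disjoint_antidiagonal :
    Pairwise (Function.onFun Disjoint fun k : ℕ => (↑(Finset.HasAntidiagonal.antidiagonal k) : Set (ℕ × ℕ))) := by
  intro k l hkl
  refine Set.disjoint_left.2 fun ij h1 h2 => hkl ?_
  simp only [Finset.mem_coe, Finset.HasAntidiagonal.mem_antidiagonal] at h1 h2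
  rw [← h1, ← h2]

/-- Pairs are grouped by their total `k`. This nonnegative form requires no integrability of `b`, so
it can serve to establish it. -/
lemma lintegral_enorm_poissonMeasure_prod (b : ℕ × ℕ → ℝ) {x y : ℝ≥0} (hxy : 0 < x + y) :
    ∫⁻ ij, ‖b ij‖ₑ ∂(poissonMeasure x).prod (poissonMeasure y)
      = ∑' k, ENNReal.ofReal
        (poissonWeight (x + y : ℝ≥0) k * binomAverage (fun ij => |b ij|) x y k) := by
  have hxy' : (x : ℝ) + y ≠ 0 := by exact_mod_cast hxy.ne'
  rw [← setLIntegral_univ, ← iUnion_antidiagonal_eq_univ,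
    lintegral_iUnion (fun k => (Finset.measurableSet _)) pairwise_disjoint_antidiagonal]
  refine tsum_congr fun k => ?_
  rw [lintegral_finset, NNReal.coe_add, ← sum_antidiagonal_poissonWeight _ hxy',
    ENNReal.ofReal_sum_of_nonneg fun ij _ => ?_]
  swap
  · exact mul_nonneg (mul_nonneg
      (poissonWeight_nonneg x.2 _) (poissonWeight_nonneg y.2 _)) (abs_nonneg _)
  refine Finset.sum_congr rfl fun ij _ => ?_
  rw [← poissonMeasure_prod_real_singleton, ENNReal.ofReal_mul measureReal_nonneg,
    ofReal_measureReal, mul_comm, Real.enorm_eq_ofReal_abs]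

lemma integral_poissonMeasure_prod {b : ℕ × ℕ → ℝ} {x y : ℝ≥0} (hxy : 0 < x + y)
    (hb : Integrable b ((poissonMeasure x).prod (poissonMeasure y))) :
    ∫ ij, b ij ∂(poissonMeasure x).prod (poissonMeasure y)
      = ∑' k, poissonWeight (x + y : ℝ≥0) k * binomAverage b x y k := by
  have hxy' : (x : ℝ) + y ≠ 0 := by exact_mod_cast hxy.ne'
  have h := hasSum_integral_iUnion (fun k => Finset.measurableSet (Finset.HasAntidiagonal.antidiagonal k))
    pairwise_disjoint_antidiagonal
    (hb.integrableOn (s := ⋃ k : ℕ, (↑(Finset.HasAntidiagonal.antidiagonal k) : Set (ℕ × ℕ))))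
  rw [iUnion_antidiagonal_eq_univ, setIntegral_univ] at h
  rw [← h.tsum_eq]
  refine tsum_congr fun k => ?_
  rw [setIntegral_finset _ hb.integrableOn, NNReal.coe_add, ← sum_antidiagonal_poissonWeight _ hxy']
  refine Finset.sum_congr rfl fun ij _ => ?_
  rw [poissonMeasure_prod_real_singleton, smul_eq_mul]

/-- The integral of the Poisson weights against the radial measure. -/
lemma lintegral_poissonWeight_radialMeasure {α : ℝ} (hα0 : 0 < α) (hα1 : α < 1) {u : ℝ≥0}
    (hu : 0 < u) {k : ℕ} (hk : 1 ≤ k) :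
    ∫⁻ r, ENNReal.ofReal (poissonWeight (r * u : ℝ≥0) k) ∂radialMeasure α
      = ENNReal.ofReal (α * (u : ℝ) ^ α * (Real.Gamma (k - α) / (k ! : ℝ))) := by
  have hu0 : (0 : ℝ) < u := hu
  have hk1 : (1 : ℝ) ≤ k := by exact_mod_cast hk
  have hkα : 0 < (k : ℝ) - α := by linarith
  have hpw : Continuous fun u : ℝ => poissonWeight u k := by
    unfold poissonWeight
    fun_prop
  rw [lintegral_radialMeasure _ (by fun_prop)]
  have h1 : ∀ r ∈ Ioi (0 : ℝ), ENNReal.ofReal (α * r ^ (-α - 1)) *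
      ENNReal.ofReal (poissonWeight (r.toNNReal * u : ℝ≥0) k)
      = ENNReal.ofReal (α * u ^ k / (k ! : ℝ) *
        (r ^ ((k : ℝ) - α - 1) * Real.exp (-(u * r)))) := by
    intro r hr
    have hr0 : 0 < r := hr
    rw [NNReal.coe_mul, Real.coe_toNNReal r hr0.le, ← ENNReal.ofReal_mul (by positivity),
      poissonWeight]
    congr 1
    have h2 : r ^ ((k : ℝ) - α - 1) = r ^ (-α - 1) * r ^ k := by
      rw [← Real.rpow_natCast, ← Real.rpow_add hr0]
      ring_nf
    rw [h2, mul_pow, mul_comm r u]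
    ring
  rw [setLIntegral_congr_fun measurableSet_Ioi h1]
  have hval := Real.integral_rpow_mul_exp_neg_mul_Ioi hkα hu0
  -- The Bochner integral of a non-integrable function is `0`, whereas `hval` gives a positive
  -- value.
  have hint : IntegrableOn (fun r : ℝ => r ^ ((k : ℝ) - α - 1) * Real.exp (-(u * r))) (Ioi 0) := by
    by_contra hcon
    have h0 := integral_undef hcon
    have : 0 < (1 / (u : ℝ)) ^ ((k : ℝ) - α) * Real.Gamma (k - α) :=
      mul_pos (by positivity) (Real.Gamma_pos_of_pos hkα)
    linarith
  rw [← ofReal_integral_eq_lintegral_ofReal (hint.const_mul _), integral_const_mul, hval]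
  · congr 1
    have h3 : (1 / (u : ℝ)) ^ ((k : ℝ) - α) * u ^ k = u ^ α := by
      rw [one_div, Real.inv_rpow hu0.le, ← Real.rpow_neg hu0.le, ← Real.rpow_natCast,
        ← Real.rpow_add hu0]
      ring_nf
    rw [← h3]
    ring
  · filter_upwards [ae_restrict_mem measurableSet_Ioi] with r hr
    have hr0 : 0 < r := hr
    positivity

lemma integrable_poissonWeight_radialMeasure {α : ℝ} (hα0 : 0 < α) (hα1 : α < 1) {u : ℝ≥0}
    (hu : 0 < u) {k : ℕ} (hk : 1 ≤ k) :
    Integrable (fun r : ℝ≥0 => poissonWeight (r * u : ℝ≥0) k) (radialMeasure α) ∧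
      ∫ r, poissonWeight (r * u : ℝ≥0) k ∂radialMeasure α
        = α * (u : ℝ) ^ α * (Real.Gamma (k - α) / (k ! : ℝ)) := by
  have hpw : Continuous fun u : ℝ => poissonWeight u k := by
    unfold poissonWeight
    fun_prop
  have hm : AEStronglyMeasurable (fun r : ℝ≥0 => poissonWeight (r * u : ℝ≥0) k)
      (radialMeasure α) := by
    have : Continuous fun r : ℝ≥0 => poissonWeight (r * u : ℝ≥0) k := by fun_prop
    exact this.aestronglyMeasurable
  have h := lintegral_poissonWeight_radialMeasure hα0 hα1 hu hk
  have hnn : ∀ r : ℝ≥0, 0 ≤ poissonWeight (r * u : ℝ≥0) k := fun r =>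
    poissonWeight_nonneg (NNReal.coe_nonneg _) k
  refine ⟨⟨hm, ?_⟩, ?_⟩
  · rw [hasFiniteIntegral_iff_ofReal (ae_of_all _ hnn), h]
    exact ENNReal.ofReal_lt_top
  · have hk1 : (1 : ℝ) ≤ k := by exact_mod_cast hk
    have := Real.Gamma_pos_of_pos (show 0 < (k : ℝ) - α by linarith)
    rw [integral_eq_lintegral_of_nonneg_ae (ae_of_all _ hnn) hm, h,
      ENNReal.toReal_ofReal (by positivity)]

/-- The radial integral of the expectation of a function of two independent Poisson variables, as
an absolutely convergent series. -/
theorem integral_radialMeasure_poissonMeasure_prod {α : ℝ} (hα0 : 0 < α) (hα1 : α < 1)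
    {b : ℕ × ℕ → ℝ} (hb0 : b (0, 0) = 0) {x y : ℝ≥0} (hxy : 0 < x + y)
    (hfin : ∫⁻ r, ∫⁻ ij, ‖b ij‖ₑ ∂(poissonMeasure (r * x)).prod (poissonMeasure (r * y))
      ∂radialMeasure α ≠ ∞) :
    Summable (fun k : ℕ => |binomAverage b x y k * Real.Gamma (k - α) / (k ! : ℝ)|) ∧
      ∫ r, ∫ ij, b ij ∂(poissonMeasure (r * x)).prod (poissonMeasure (r * y)) ∂radialMeasure α
        = α * ((x : ℝ) + y) ^ α *
          ∑' k : ℕ, binomAverage b x y k * Real.Gamma (k - α) / (k ! : ℝ) := by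
  set u : ℝ≥0 := x + y with hu
  have hu0 : (0 : ℝ) < u := hxy
  let A : ℕ → ℝ := binomAverage (fun ij => |b ij|) x y
  have hA0 : ∀ k, 0 ≤ A k := fun k => binomAverage_nonneg (fun ij => abs_nonneg _) x.2 y.2 k
  -- Removing `k = 0` is essential: there the radial integral diverges at `0`, and `Γ(-α)` is
  -- negative.
  have hAz : A 0 = 0 := by simp [A, binomAverage_zero, hb0]
  have hBz : binomAverage b x y 0 = 0 := by rw [binomAverage_zero, hb0]
  let c : ℕ → ℝ := fun k => α * (u : ℝ) ^ α * (Real.Gamma (k - α) / (k ! : ℝ))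
  have hc0 : ∀ k, 1 ≤ k → 0 ≤ c k := by
    intro k hk
    have hk1 : (1 : ℝ) ≤ k := by exact_mod_cast hk
    have := Real.Gamma_pos_of_pos (show 0 < (k : ℝ) - α by linarith)
    positivity
  have hcont : ∀ k, Continuous fun r : ℝ≥0 => poissonWeight (r * u : ℝ≥0) k := by
    intro k
    unfold poissonWeight
    fun_prop
  have hlin : ∀ r : ℝ≥0, 0 < r →
      ∫⁻ ij, ‖b ij‖ₑ ∂(poissonMeasure (r * x)).prod (poissonMeasure (r * y))
        = ∑' k, ENNReal.ofReal (poissonWeight (r * u : ℝ≥0) k * A k) := by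
    intro r hr
    rw [lintegral_enorm_poissonMeasure_prod b (by rw [← mul_add]; positivity), ← mul_add]
    simp only [NNReal.coe_mul, binomAverage_mul_left _ (NNReal.coe_ne_zero.2 hr.ne'), A]
    rfl
  have hlin_ae : (fun r => ∫⁻ ij, ‖b ij‖ₑ ∂(poissonMeasure (r * x)).prod (poissonMeasure (r * y)))
      =ᵐ[radialMeasure α] fun r => ∑' k, ENNReal.ofReal (poissonWeight (r * u : ℝ≥0) k * A k) := by
    filter_upwards [ae_radialMeasure_pos α] with r hr using hlin r hr
  have hmeas : ∀ k, Measurable fun r : ℝ≥0 =>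
      ENNReal.ofReal (poissonWeight (r * u : ℝ≥0) k * A k) := fun k =>
    ENNReal.measurable_ofReal.comp ((hcont k).measurable.mul_const _)
  rw [lintegral_congr_ae hlin_ae] at hfin
  have hfin' := hfin
  -- Tonelli turns the finiteness hypothesis into summability of `c k * A k`, which dominates the
  -- signed series. The copy `hfin'` is kept for finiteness at almost every `r`.
  rw [lintegral_tsum fun k => (hmeas k).aemeasurable] at hfin
  have hterm : ∀ k, ∫⁻ r, ENNReal.ofReal (poissonWeight (r * u : ℝ≥0) k * A k) ∂radialMeasure α
      = ENNReal.ofReal (c k * A k) := by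
    intro k
    rcases Nat.eq_zero_or_pos k with rfl | hk
    · simp [hAz]
    · simp_rw [ENNReal.ofReal_mul' (hA0 k)]
      rw [lintegral_mul_const' _ _ (by simp), lintegral_poissonWeight_radialMeasure hα0 hα1 hxy hk]
  simp_rw [hterm] at hfin
  have hcA : ∀ k, 0 ≤ c k * A k := by
    intro k
    rcases Nat.eq_zero_or_pos k with rfl | hk
    · simp [hAz]
    · exact mul_nonneg (hc0 k hk) (hA0 k)
  have hsumA : Summable fun k => c k * A k := by
    have h := ENNReal.summable_toReal hfin
    simpa only [ENNReal.toReal_ofReal (hcA _)] using h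
  have habs : ∀ k, |c k * binomAverage b x y k| ≤ c k * A k := by
    intro k
    rcases Nat.eq_zero_or_pos k with rfl | hk
    · simp [hAz, hBz]
    · rw [abs_mul, abs_of_nonneg (hc0 k hk)]
      exact mul_le_mul_of_nonneg_left (abs_binomAverage_le b x.2 y.2 k) (hc0 k hk)
  have hsumB : Summable fun k => |c k * binomAverage b x y k| :=
    hsumA.of_nonneg_of_le (fun k => abs_nonneg _) habs
  have hcu : ∀ k, c k * binomAverage b x y k
      = α * (u : ℝ) ^ α * (binomAverage b x y k * Real.Gamma (k - α) / (k ! : ℝ)) := by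
    intro k
    simp only [c]
    ring
  have hαu : 0 < α * (u : ℝ) ^ α := by positivity
  refine ⟨?_, ?_⟩
  · simp_rw [hcu, abs_mul (α * (u : ℝ) ^ α)] at hsumB
    exact (summable_mul_left_iff (abs_pos.2 hαu.ne').ne').1 hsumB
  · let F : ℕ → ℝ≥0 → ℝ := fun k r => poissonWeight (r * u : ℝ≥0) k * binomAverage b x y k
    have hF : ∀ k, Integrable (F k) (radialMeasure α) := by
      intro k
      rcases Nat.eq_zero_or_pos k with rfl | hk
      · simp [F, hBz]
      · exact (integrable_poissonWeight_radialMeasure hα0 hα1 hxy hk).1.mul_const _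
    have hFint : ∀ k, ∫ r, F k r ∂radialMeasure α = c k * binomAverage b x y k := by
      intro k
      rcases Nat.eq_zero_or_pos k with rfl | hk
      · simp [F, hBz]
      · rw [integral_mul_const, (integrable_poissonWeight_radialMeasure hα0 hα1 hxy hk).2]
    have hFnorm : ∀ k, ∫ r, ‖F k r‖ ∂radialMeasure α = |c k * binomAverage b x y k| := by
      intro k
      rcases Nat.eq_zero_or_pos k with rfl | hk
      · simp [F, hBz]
      · have h1 : ∀ r, ‖F k r‖ = poissonWeight (r * u : ℝ≥0) k * |binomAverage b x y k| := by
          intro r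
          rw [norm_mul, Real.norm_eq_abs, Real.norm_eq_abs,
            abs_of_nonneg (poissonWeight_nonneg (NNReal.coe_nonneg _) k)]
        simp_rw [h1]
        rw [integral_mul_const, (integrable_poissonWeight_radialMeasure hα0 hα1 hxy hk).2, abs_mul,
          abs_of_nonneg (hc0 k hk)]
    have hsum := hasSum_integral_of_summable_integral_norm hF (by simpa only [hFnorm] using hsumB)
    have hae : (fun r => ∫ ij, b ij ∂(poissonMeasure (r * x)).prod (poissonMeasure (r * y)))
        =ᵐ[radialMeasure α] fun r => ∑' k, F k r := by
      filter_upwards [ae_radialMeasure_pos α,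
        ae_lt_top' (Measurable.tsum hmeas).aemeasurable hfin'] with r hr hr'
      rw [← hlin r hr] at hr'
      rw [integral_poissonMeasure_prod (by rw [← mul_add]; positivity)
        ⟨Measurable.of_discrete.aestronglyMeasurable, hr'⟩, ← mul_add]
      simp only [NNReal.coe_mul, binomAverage_mul_left _ (NNReal.coe_ne_zero.2 hr.ne'), F]
      rfl
    rw [integral_congr_ae hae, ← hsum.tsum_eq, ← NNReal.coe_add, ← tsum_mul_left]
    simp_rw [hFint, hcu]
    rfl

end PoissonSeries

/-! ### The two covariance series -/

section Covariance

lemma binomAverage_eq_weightF1 {a : ℕ → ℝ} (ha0 : a 0 = 0) {s t : ℝ} (ht : t ≠ 0) (k : ℕ) :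
    binomAverage (fun ij => a ij.1 * a (ij.1 + ij.2)) s (t - s) k = weightF1 a s t k := by
  rw [binomAverage, Finset.Nat.sum_antidiagonal_eq_sum_range_succ_mk, weightF1]
  have hsub : Finset.Icc 1 k ⊆ Finset.range k.succ := fun j hj =>
    Finset.mem_range.2 (Nat.lt_succ_of_le (Finset.mem_Icc.1 hj).2)
  rw [← Finset.sum_subset hsub]
  · refine Finset.sum_congr rfl fun j hj => ?_
    rw [Nat.add_sub_cancel' (Finset.mem_Icc.1 hj).2, add_sub_cancel, sub_div, div_self ht]
    ring
  · intro j hj hj'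
    have : j = 0 := by
      simp only [Finset.mem_range, Finset.mem_Icc] at hj hj'
      lia
    simp [this, ha0]

lemma binomAverage_eq_weightF2 {a : ℕ → ℝ} (ha0 : a 0 = 0) (s t : ℝ) (k : ℕ) :
    binomAverage (fun ij => a ij.1 * a ij.2) s t k = weightF2 a s t k := by
  rw [binomAverage, Finset.Nat.sum_antidiagonal_eq_sum_range_succ_mk, weightF2]
  have hsub : Finset.Icc 1 (k - 1) ⊆ Finset.range k.succ := fun j hj => by
    simp only [Finset.mem_range, Finset.mem_Icc] at hj ⊢
    lia
  rw [← Finset.sum_subset hsub]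
  · refine Finset.sum_congr rfl fun j _ => ?_
    ring
  · intro j hj hj'
    have : j = 0 ∨ k - j = 0 := by
      simp only [Finset.mem_range, Finset.mem_Icc] at hj hj'
      lia
    rcases this with h | h <;> simp [h, ha0]

variable {Ω' : Type*} [MeasurableSpace Ω'] {P' : Measure Ω'} [IsProbabilityMeasure P']
  {N : ℝ≥0 → Ω' → ℕ} {a : ℕ → ℝ} {α : ℝ}

namespace IsStandardPoissonProcess

variable (hN : IsStandardPoissonProcess N P')

lemma integrable_integral_mul_integral
    (hmem : ∀ t, MemLp (fun x : ℝ≥0 × Ω' => a (N (x.1 * t) x.2)) 2 (intensity α P'))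
    (s t : ℝ≥0) :
    Integrable (fun r => (∫ ω, a (N (r * s) ω) ∂P') * ∫ ω, a (N (r * t) ω) ∂P')
      (radialMeasure α) := by
  have h := ((eLpNorm_integral_prod_le (hmem s)).1.integrable_mul
    (eLpNorm_integral_prod_le (hmem t)).1).integral_prod_left
  simpa using h

/-- For fixed `r` the kernels are centered under `P'`, so the inner integral is a covariance. Its
two terms are separately integrable in `r`. -/
lemma integral_zKernel_mul
    (hmem : ∀ t, MemLp (fun x : ℝ≥0 × Ω' => a (N (x.1 * t) x.2)) 2 (intensity α P'))
    (hmem' : ∀ t, MemLp (fun ω => a (N t ω)) 2 P') (s t : ℝ≥0) :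
    ∫ x, zKernel a N P' s x * zKernel a N P' t x ∂intensity α P'
      = ∫ r, ∫ ω, a (N (r * s) ω) * a (N (r * t) ω) ∂P' ∂radialMeasure α
        - ∫ r, (∫ ω, a (N (r * s) ω) ∂P') * (∫ ω, a (N (r * t) ω) ∂P') ∂radialMeasure α := by
  have hz : Integrable (fun x => zKernel a N P' s x * zKernel a N P' t x) (intensity α P') :=
    (memLp_sub_integral_prod (hmem s)).integrable_mul (memLp_sub_integral_prod (hmem t))
  have h1 : Integrable (fun r => ∫ ω, a (N (r * s) ω) * a (N (r * t) ω) ∂P')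
      (radialMeasure α) := ((hmem s).integrable_mul (hmem t)).integral_prod_left
  rw [← integral_sub h1 (integrable_integral_mul_integral hmem s t)]
  unfold intensity at hz ⊢
  rw [integral_prod _ hz]
  refine integral_congr_ae (ae_of_all _ fun r => ?_)
  exact covariance_eq_sub (hmem' (r * s)) (hmem' (r * t))

include hN

/-- `N(rt)` is `N(rs)` plus an independent increment; the parameters `rs` and `r(t - s)` add up to
`rt`, whence `t ^ α`. -/
lemma integral_radialMeasure_mul (ha0 : a 0 = 0) (hα0 : 0 < α) (hα1 : α < 1)
    (hmem : ∀ t, MemLp (fun x : ℝ≥0 × Ω' => a (N (x.1 * t) x.2)) 2 (intensity α P'))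
    {s t : ℝ≥0} (hs : 0 < s) (hst : s < t) :
    Summable (fun k => |covTerm1 α a s t k|) ∧
      ∫ r, ∫ ω, a (N (r * s) ω) * a (N (r * t) ω) ∂P' ∂radialMeasure α
        = α * (t : ℝ) ^ α * ∑' k, covTerm1 α a s t k := by
  let b : ℕ × ℕ → ℝ := fun ij => a ij.1 * a (ij.1 + ij.2)
  have hlaw : ∀ r : ℝ≥0, HasLaw (fun ω => (N (r * s) ω, N (r * t) ω - N (r * s) ω))
      ((poissonMeasure (r * s)).prod (poissonMeasure (r * (t - s)))) P' := by
    intro r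
    rw [mul_tsub]
    exact hN.hasLaw_prodMk_increment (by gcongr)
  have hb : ∀ r : ℝ≥0, ∀ᵐ ω ∂P', b (N (r * s) ω, N (r * t) ω - N (r * s) ω)
      = a (N (r * s) ω) * a (N (r * t) ω) := by
    intro r
    have hrst : r * s ≤ r * t := by gcongr
    filter_upwards [hN.ae_add_increment hrst] with ω hω
    simp only [b, hω]
  have hint : ∀ r : ℝ≥0, ∫ ω, a (N (r * s) ω) * a (N (r * t) ω) ∂P'
      = ∫ ij, b ij ∂(poissonMeasure (r * s)).prod (poissonMeasure (r * (t - s))) := by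
    intro r
    rw [← (hlaw r).integral_comp Measurable.of_discrete.aestronglyMeasurable]
    exact integral_congr_ae ((hb r).mono fun ω hω => hω.symm)
  have hlint : ∀ r : ℝ≥0, ∫⁻ ω, ‖a (N (r * s) ω) * a (N (r * t) ω)‖ₑ ∂P'
      = ∫⁻ ij, ‖b ij‖ₑ ∂(poissonMeasure (r * s)).prod (poissonMeasure (r * (t - s))) := by
    intro r
    rw [← (hlaw r).lintegral_comp (f := fun ij => ‖b ij‖ₑ) (by fun_prop)]
    exact lintegral_congr_ae ((hb r).mono fun ω hω => by simp only [hω])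
  have hprod := (hmem s).integrable_mul (hmem t)
  have hfin := hprod.2
  rw [hasFiniteIntegral_iff_enorm, intensity, lintegral_prod _ hprod.1.enorm] at hfin
  simp only [Pi.mul_apply, hlint] at hfin
  have h := integral_radialMeasure_poissonMeasure_prod hα0 hα1 (b := b) (by simp [b, ha0])
    (by rw [add_tsub_cancel_of_le hst.le]; exact hs.trans hst) hfin.ne
  rw [NNReal.coe_sub hst.le, add_sub_cancel] at h
  have ht : (t : ℝ) ≠ 0 := NNReal.coe_ne_zero.2 (hs.trans hst).ne'
  simp only [b, binomAverage_eq_weightF1 ha0 ht] at h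
  simp only [hint]
  exact h

/-- A product of means is the mean over independent copies; the parameters `rs` and `rt` add up to
`r(s + t)`, whence `(s + t) ^ α`. -/
lemma integral_radialMeasure_mul_integral (ha0 : a 0 = 0) (hα0 : 0 < α) (hα1 : α < 1)
    (hmem : ∀ t, MemLp (fun x : ℝ≥0 × Ω' => a (N (x.1 * t) x.2)) 2 (intensity α P'))
    {s t : ℝ≥0} (hs : 0 < s) :
    Summable (fun k => |covTerm2 α a s t k|) ∧
      ∫ r, (∫ ω, a (N (r * s) ω) ∂P') * (∫ ω, a (N (r * t) ω) ∂P') ∂radialMeasure α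
        = α * ((s : ℝ) + t) ^ α * ∑' k, covTerm2 α a s t k := by
  let b : ℕ × ℕ → ℝ := fun ij => a ij.1 * a ij.2
  have hmean : ∀ (f : ℕ → ℝ) u, ∫ ω, f (N u ω) ∂P' = ∫ k, f k ∂poissonMeasure u := fun f u =>
    (hN.hasLaw u).integral_comp (f := f) Measurable.of_discrete.aestronglyMeasurable
  have hint : ∀ r : ℝ≥0, (∫ ω, a (N (r * s) ω) ∂P') * (∫ ω, a (N (r * t) ω) ∂P')
      = ∫ ij, b ij ∂(poissonMeasure (r * s)).prod (poissonMeasure (r * t)) := by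
    intro r
    rw [hmean a, hmean a]
    exact (integral_prod_mul a a).symm
  -- Absolute convergence comes from the integrability of the product of means with `|a|` in place
  -- of `a`.
  have hmem_abs : ∀ t, MemLp (fun x : ℝ≥0 × Ω' => |a (N (x.1 * t) x.2)|) 2 (intensity α P') :=
    fun t => (hmem t).abs
  have hlint : ∀ r : ℝ≥0,
      ∫⁻ ij, ‖b ij‖ₑ ∂(poissonMeasure (r * s)).prod (poissonMeasure (r * t))
        = (∫⁻ ω, ‖a (N (r * s) ω)‖ₑ ∂P') * ∫⁻ ω, ‖a (N (r * t) ω)‖ₑ ∂P' := by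
    intro r
    rw [(hN.hasLaw (r * s)).lintegral_comp (f := fun k => ‖a k‖ₑ) (by fun_prop),
      (hN.hasLaw (r * t)).lintegral_comp (f := fun k => ‖a k‖ₑ) (by fun_prop),
      ← lintegral_prod_mul (by fun_prop) (by fun_prop)]
    simp only [b, enorm_mul]
  have hae : ∀ t : ℝ≥0, ∀ᵐ r ∂radialMeasure α,
      ∫⁻ ω, ‖a (N (r * t) ω)‖ₑ ∂P' = ‖∫ ω, |a (N (r * t) ω)| ∂P'‖ₑ := by
    intro t
    have h1 : ∀ᵐ r ∂radialMeasure α, MemLp (fun ω => a (N (r * t) ω)) 2 P' := by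
      have h2 := (hmem t).integrable_sq.prod_right_ae
      filter_upwards [h2, (hmem t).1.prodMk_left] with r hr hr'
      exact (memLp_two_iff_integrable_sq hr').2 hr
    filter_upwards [h1] with r hr
    have hi : Integrable (fun ω => a (N (r * t) ω)) P' := hr.integrable (by norm_num)
    rw [Real.enorm_eq_ofReal_abs, abs_of_nonneg (integral_nonneg fun ω => abs_nonneg _),
      ofReal_integral_eq_lintegral_ofReal hi.abs (ae_of_all _ fun ω => abs_nonneg _)]
    exact lintegral_congr fun ω => Real.enorm_eq_ofReal_abs _
  have hfin : ∫⁻ r, ∫⁻ ij, ‖b ij‖ₑ ∂(poissonMeasure (r * s)).prod (poissonMeasure (r * t))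
      ∂radialMeasure α ≠ ∞ := by
    have h := (integrable_integral_mul_integral (a := fun k => |a k|) hmem_abs s t).2
    rw [hasFiniteIntegral_iff_enorm] at h
    refine ne_of_lt (lt_of_eq_of_lt (lintegral_congr_ae ?_) h)
    filter_upwards [hae s, hae t] with r h1 h2
    rw [hlint, h1, h2, enorm_mul]
  have h := integral_radialMeasure_poissonMeasure_prod hα0 hα1 (b := b) (by simp [b, ha0])
    (add_pos_of_pos_of_nonneg hs zero_le) hfin
  simp only [b, binomAverage_eq_weightF2 ha0] at h
  simp only [hint]
  exact h

end IsStandardPoissonProcess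

end Covariance

/-! ### Moments of Gaussian variables -/

section GaussianMoments

variable {Ω : Type*} [MeasurableSpace Ω] {P : Measure Ω}

/-- The even moments of a centered Gaussian variable in terms of its second moment. -/
lemma lintegral_enorm_pow_of_hasGaussianLaw [IsProbabilityMeasure P] {X : Ω → ℝ}
    (hX : HasGaussianLaw X P) (hX0 : ∫ ω, X ω ∂P = 0) (p : ℕ) :
    ∫⁻ ω, ‖X ω‖ₑ ^ (2 * p) ∂P
      = (∫⁻ z, ‖z‖ₑ ^ (2 * p) ∂gaussianReal 0 1) * (∫⁻ ω, ‖X ω‖ₑ ^ 2 ∂P) ^ p := by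
  have hm := hX.aemeasurable
  have hlaw : P.map X = (gaussianReal 0 1).map (√Var[X; P] * ·) := by
    rw [hX.isGaussian_map.eq_gaussianReal, integral_map hm (by fun_prop),
      variance_map (by fun_prop) hm, gaussianReal_map_const_mul]
    simp only [id_eq, Function.id_comp, hX0, mul_zero, mul_one]
    congr 1
    ext
    simp [variance_nonneg]
  have hsq : ∫⁻ ω, ‖X ω‖ₑ ^ 2 ∂P = ‖√Var[X; P]‖ₑ ^ 2 := by
    rw [Real.enorm_eq_ofReal (Real.sqrt_nonneg _), ← ENNReal.ofReal_pow (Real.sqrt_nonneg _),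
      Real.sq_sqrt (variance_nonneg _ _), hX.memLp_two.ofReal_variance_eq, evariance]
    simp [hX0]
  have h : ∫⁻ ω, ‖X ω‖ₑ ^ (2 * p) ∂P = ∫⁻ z, ‖z‖ₑ ^ (2 * p) ∂P.map X :=
    (lintegral_map' (f := fun z : ℝ => ‖z‖ₑ ^ (2 * p)) (by fun_prop) hm).symm
  rw [h, hlaw, lintegral_map (by fun_prop) (by fun_prop), hsq, ← pow_mul,
    ← lintegral_mul_const _ (by fun_prop)]
  exact lintegral_congr fun z => by rw [enorm_mul, mul_pow, mul_comm]

lemma lintegral_enorm_pow_gaussianReal_lt_top (p : ℕ) :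
    ∫⁻ z, ‖z‖ₑ ^ (2 * p) ∂gaussianReal 0 1 < ∞ := by
  have h := (memLp_id_gaussianReal (μ := 0) (v := 1) ((2 * p : ℕ) : ℝ≥0)).integrable_norm_pow'
  refine lt_of_eq_of_lt (lintegral_congr fun z => ?_) (hasFiniteIntegral_iff_enorm.1 h.2)
  simp [enorm_pow]

end GaussianMoments

/-- Increments starting from `i = 0` also occur, because `N` may still be at `0`; as `a 0 = 0`, the
growth bound covers them. The two bounds merge since `j ≥ 1`. -/
lemma abs_increment_le_of_growth {a : ℕ → ℝ} (ha0 : a 0 = 0) {C β C' β' : ℝ}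
    (ha : ∀ j : ℕ, 1 ≤ j → |a j| ≤ C * (j : ℝ) ^ β)
    (ha' : ∀ i j : ℕ, 1 ≤ i → 1 ≤ j → |a (i + j) - a i| ≤ C' * (j : ℝ) ^ β') (i j : ℕ)
    (hj : 1 ≤ j) : |a (i + j) - a i| ≤ max |C| |C'| * (j : ℝ) ^ max β β' := by
  have hj1 : (1 : ℝ) ≤ j := by exact_mod_cast hj
  rcases Nat.eq_zero_or_pos i with rfl | hi
  · rw [zero_add, ha0, sub_zero]
    refine (ha j hj).trans ?_
    gcongr
    · exact (le_abs_self C).trans (le_max_left _ _)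
    · exact le_max_left _ _
  · refine (ha' i j hi hj).trans ?_
    gcongr
    · exact (le_abs_self C').trans (le_max_right _ _)
    · exact le_max_right _ _

/-! ### Hölder modification and conclusion -/

section KarlinProcess

variable {Ω Ω' : Type*} [MeasurableSpace Ω] [MeasurableSpace Ω'] {P : Measure Ω}
  [IsProbabilityMeasure P] {P' : Measure Ω'} [IsProbabilityMeasure P'] {N : ℝ≥0 → Ω' → ℕ}
  {M : Set (ℝ≥0 × Ω') → Ω → ℝ} {a : ℕ → ℝ} {α : ℝ}

/-- Stochastic integrals of the kernels have Hölder modifications when the increments of `a` have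
moderate growth. -/
lemma exists_holder_modification_of_increments (hα0 : 0 < α) (hα1 : α < 1)
    (hN : IsStandardPoissonProcess N P') (hM : IsGaussianRandomMeasure M (intensity α P') P)
    {C β : ℝ} (hβ0 : 0 ≤ β) (hβ : β < α / 2)
    (hint : ∀ t, Integrable (fun ω => a (N t ω)) P')
    (ha : ∀ i j : ℕ, 1 ≤ j → |a (i + j) - a i| ≤ C * (j : ℝ) ^ β) {Z : ℝ≥0 → Ω → ℝ}
    (hZ : ∀ t, IsStochInt M (intensity α P') P (zKernel a N P' t) (Z t)) :
    ∃ Y : ℝ≥0 → Ω → ℝ, (∀ t, Measurable (Y t)) ∧ (∀ t, Y t =ᵐ[P] Z t) ∧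
      ∀ γ : ℝ≥0, 0 < γ → (γ : ℝ) < α / 2 → ∀ ω, ∀ T : ℝ≥0,
        ∃ K : ℝ≥0, HolderOnWith K γ (fun t => Y t ω) (Icc 0 T) := by
  -- The integrals are only almost everywhere measurable; chaining uses measurable representatives.
  have hmk : ∀ t, Z t =ᵐ[P] (hZ t).2.1.1.mk (Z t) := fun t => (hZ t).2.1.1.ae_eq_mk
  set D : ℝ := C ^ 2 * radialConst α (2 * β) with hD
  have hD0 : 0 ≤ D := mul_nonneg (sq_nonneg C) (radialConst_nonneg hα0 hα1 (by linarith))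
  -- The `4` is the square of the factor `2` lost in centering.
  have hsecond_le : ∀ s t, s ≤ t →
      ∫⁻ ω, ‖Z t ω - Z s ω‖ₑ ^ 2 ∂P ≤ 4 * ENNReal.ofReal D * edist t s ^ α := by
    intro s t hst
    have h1 := hN.eLpNorm_zKernel_sub_le hα0 hα1 hβ0 hβ hint ha hst
    rw [← hM.eLpNorm_sub_of_isStochInt (hZ t) (hZ s),
      eLpNorm_eq_lintegral_rpow_enorm_toReal (by norm_num) (by norm_num)] at h1
    have h2 := ENNReal.rpow_le_rpow h1 (show (0 : ℝ) ≤ 2 by norm_num)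
    rw [ENNReal.mul_rpow_of_nonneg _ _ (by norm_num), ← ENNReal.rpow_mul, ← ENNReal.rpow_mul] at h2
    norm_num at h2
    have hed : edist t s = ENNReal.ofReal ((t - s : ℝ≥0) : ℝ) := by
      rw [edist_nndist, NNReal.nndist_eq, tsub_eq_zero_of_le hst, max_eq_left zero_le,
        ENNReal.ofReal_coe_nnreal]
    rw [hed, ENNReal.ofReal_rpow_of_nonneg (NNReal.coe_nonneg _) hα0.le, mul_assoc,
      ← ENNReal.ofReal_mul hD0]
    exact h2
  have hsecond : ∀ s t,
      ∫⁻ ω, ‖Z t ω - Z s ω‖ₑ ^ 2 ∂P ≤ 4 * ENNReal.ofReal D * edist t s ^ α := by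
    intro s t
    rcases le_total s t with h | h
    · exact hsecond_le s t h
    · have h1 := hsecond_le t s h
      simp_rw [← edist_eq_enorm_sub] at h1 ⊢
      simpa only [edist_comm] using h1
  have hG := hM.isGaussianProcess_of_isStochInt hZ
  have hmom : ∀ p : ℕ, ∃ K : ℝ≥0, ∀ s t,
      ∫⁻ ω, ‖(hZ t).2.1.1.mk (Z t) ω - (hZ s).2.1.1.mk (Z s) ω‖ₑ ^ (2 * p) ∂P
        ≤ K * edist t s ^ ((2 * p : ℕ) * (α / 2)) := by
    intro p
    set m := ∫⁻ z, ‖z‖ₑ ^ (2 * p) ∂gaussianReal 0 1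
    have hfin : m * (4 * ENNReal.ofReal D) ^ p ≠ ∞ :=
      ENNReal.mul_ne_top (lintegral_enorm_pow_gaussianReal_lt_top p).ne
        (ENNReal.pow_ne_top (ENNReal.mul_ne_top (by norm_num) (by simp)))
    refine ⟨(m * (4 * ENNReal.ofReal D) ^ p).toNNReal, fun s t => ?_⟩
    have h0 : ∫ ω, (Z t ω - Z s ω) ∂P = 0 := by
      rw [integral_sub ((hZ t).2.1.integrable (by norm_num)) ((hZ s).2.1.integrable (by norm_num)),
        hM.integral_of_isStochInt (hZ t), hM.integral_of_isStochInt (hZ s), sub_zero]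
    calc ∫⁻ ω, ‖(hZ t).2.1.1.mk (Z t) ω - (hZ s).2.1.1.mk (Z s) ω‖ₑ ^ (2 * p) ∂P
        = ∫⁻ ω, ‖Z t ω - Z s ω‖ₑ ^ (2 * p) ∂P := by
          refine lintegral_congr_ae ?_
          filter_upwards [hmk t, hmk s] with ω h1 h2
          rw [h1, h2]
      _ = m * (∫⁻ ω, ‖Z t ω - Z s ω‖ₑ ^ 2 ∂P) ^ p :=
          lintegral_enorm_pow_of_hasGaussianLaw hG.hasGaussianLaw_fun_sub h0 p
      _ ≤ m * (4 * ENNReal.ofReal D * edist t s ^ α) ^ p := by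
          gcongr
          exact hsecond s t
      _ = (m * (4 * ENNReal.ofReal D) ^ p).toNNReal * edist t s ^ ((2 * p : ℕ) * (α / 2)) := by
          rw [ENNReal.coe_toNNReal hfin, mul_pow, ← mul_assoc, ← ENNReal.rpow_natCast (_ ^ α),
            ← ENNReal.rpow_mul]
          congr 2
          push_cast
          ring
  obtain ⟨Y, hYm, hYZ, hYH⟩ := exists_modification_holder
    (fun t => (hZ t).2.1.1.stronglyMeasurable_mk.measurable) (half_pos hα0) hmom
  exact ⟨Y, hYm, fun t => (hYZ t).trans (hmk t).symm, hYH⟩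

end KarlinProcess

theorem proposition2p1
    {Ω Ω' : Type*} [MeasurableSpace Ω] [MeasurableSpace Ω']
    (P : Measure Ω) [IsProbabilityMeasure P] (P' : Measure Ω') [IsProbabilityMeasure P']
    (α : ℝ) (hα0 : 0 < α) (hα1 : α < 1)
    (N : ℝ≥0 → Ω' → ℕ) (hN : IsStandardPoissonProcess N P')
    (M : Set (ℝ≥0 × Ω') → Ω → ℝ) (hM : IsGaussianRandomMeasure M (intensity α P') P)
    (a : ℕ → ℝ) (ha0 : a 0 = 0)
    (C β : ℝ) (hβ0 : 0 ≤ β) (hβ : β < α / 2)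
    (ha : ∀ j : ℕ, 1 ≤ j → |a j| ≤ C * (j : ℝ) ^ β) :
    -- the integrand and the stochastic integral defining each `Z_α(t)` are well defined
    (∀ t : ℝ≥0, Integrable (fun ω' => a (N t ω')) P') ∧
    (∀ t : ℝ≥0,
      IsStochInt M (intensity α P') P (zKernel a N P' t) (karlinZ α a N P' M P t) ∧
      ∀ X : Ω → ℝ, IsStochInt M (intensity α P') P (zKernel a N P' t) X →
        X =ᵐ[P] karlinZ α a N P' M P t) ∧
    -- they form a centered Gaussian family
    IsGaussianProcess (karlinZ α a N P' M P) P ∧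
    (∀ t : ℝ≥0, ∫ ω, karlinZ α a N P' M P t ω ∂P = 0) ∧
    -- the covariance is given by two absolutely convergent series
    (∀ s t : ℝ≥0, 0 < s → s < t →
      Summable (fun k : ℕ => |covTerm1 α a s t (k + 1)|) ∧
      Summable (fun k : ℕ => |covTerm2 α a s t (k + 2)|) ∧
      cov[karlinZ α a N P' M P s, karlinZ α a N P' M P t; P] =
        α * (t : ℝ) ^ α * ∑' k : ℕ, covTerm1 α a s t (k + 1)
          - α * ((s : ℝ) + t) ^ α * ∑' k : ℕ, covTerm2 α a s t (k + 2)) ∧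
    -- under the increment condition there is a version with locally Hölder continuous paths
    (∀ C' β' : ℝ, 0 ≤ β' → β' < α / 2 →
      (∀ i j : ℕ, 1 ≤ i → 1 ≤ j → |a (i + j) - a i| ≤ C' * (j : ℝ) ^ β') →
      ∃ Y : ℝ≥0 → Ω → ℝ,
        (∀ t, Measurable (Y t)) ∧
        (∀ t, Y t =ᵐ[P] karlinZ α a N P' M P t) ∧
        ∀ γ : ℝ≥0, 0 < γ → (γ : ℝ) < α / 2 → ∀ ω, ∀ T : ℝ≥0,
          ∃ K : ℝ≥0, HolderOnWith K γ (fun t => Y t ω) (Icc 0 T)) := by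
  have hmem := fun t => hN.memLp_time_change_of_growth ha0 hα0 hα1 hβ0 hβ ha t
  have hmem' := fun t => hN.memLp_of_growth ha0 (by linarith) ha t
  have hint : ∀ t : ℝ≥0, Integrable (fun ω' => a (N t ω')) P' := fun t =>
    (hmem' t).integrable (by norm_num)
  have hZ : ∀ t : ℝ≥0,
      IsStochInt M (intensity α P') P (zKernel a N P' t) (karlinZ α a N P' M P t) := fun t =>
    hM.isStochInt_stochInt (hN.memLp_zKernel ha0 hα0 hα1 hβ0 hβ ha t)
  refine ⟨hint, fun t => ⟨hZ t, fun X hX => hM.ae_eq_of_isStochInt hX (hZ t)⟩,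
    hM.isGaussianProcess_of_isStochInt hZ, fun t => hM.integral_of_isStochInt (hZ t),
    fun s t hs hst => ?_, fun C' β' hβ'0 hβ' ha' => ?_⟩
  · obtain ⟨hs1, h1⟩ := hN.integral_radialMeasure_mul ha0 hα0 hα1 hmem hs hst
    obtain ⟨hs2, h2⟩ := hN.integral_radialMeasure_mul_integral ha0 hα0 hα1 hmem (t := t) hs
    refine ⟨(summable_nat_add_iff 1).2 hs1, (summable_nat_add_iff 2).2 hs2, ?_⟩
    -- The terms below the starting indices `1` and `2` are empty sums.
    have hF1 : covTerm1 α a s t 0 = 0 := by simp [covTerm1, weightF1]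
    have hF2 : ∀ k < 2, covTerm2 α a s t k = 0 := by
      intro k hk
      interval_cases k <;> simp [covTerm2, weightF2]
    have ht1 : ∑' k, covTerm1 α a s t k = ∑' k, covTerm1 α a s t (k + 1) := by
      rw [hs1.of_abs.tsum_eq_zero_add, hF1, zero_add]
    have ht2 : ∑' k, covTerm2 α a s t k = ∑' k, covTerm2 α a s t (k + 2) := by
      rw [← hs2.of_abs.sum_add_tsum_nat_add 2,
        Finset.sum_eq_zero fun k hk => hF2 k (Finset.mem_range.1 hk), zero_add]
    rw [covariance_eq_sub (hZ s).2.1 (hZ t).2.1, hM.integral_of_isStochInt (hZ s), zero_mul,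
      sub_zero, ← ht1, ← ht2, ← h1, ← h2,
      ← IsStandardPoissonProcess.integral_zKernel_mul hmem hmem']
    exact hM.integral_mul_of_isStochInt (hZ s) (hZ t)
  · exact exists_holder_modification_of_increments hα0 hα1 hN hM (hβ0.trans (le_max_left β β'))
      (max_lt hβ hβ') hint (abs_increment_le_of_growth ha0 ha ha') hZ
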